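/- Let $b,\mu\in\mathbb R$ and $\sigma,\lambda,\delta,T>0$. Let $W$ be a standard Brownian motion, $N$ a Poisson process with intensity $\lambda$, and $Y_1,Y_2,\dots$ i.i.d. normal random variables with mean $\mu$ and variance $\delta^2$, where $W$, $N$ and $(Y_j)_{j\ge 1}$ are independent. Let $$X_T = bT+\sigma W_T+\sum_{j=1}^{N_T}Y_j$$ be the log-return of the Merton jump diffusion model and $S_T=e^{X_T}$ the price of the underlying. Write $M(s,T)=\mathbb E[e^{sX_T}]$ (finite for all real $s$), $m=\log M$, and let $'$ denote differentiation with respect to $s$. For each $k\in\mathbb R$ the equation $m'(\hat s,T)=k$ has exactly one real solution $\hat s=\hat s(k)$. The random variable $X_T$ has a continuous density $f_{X_T}$ on $\mathbb R$, and, as $k\to\infty$, $$f_{X_T}(k)=\frac{e^{-k\hat s}M(\hat s,T)}{\sqrt{2\pi\,m''(\hat s,T)}}\bigl(1+O(k^{-1/2})\bigr)$$ $$=\frac{\exp\Bigl(-k\hat s+T\bigl(\tfrac{\sigma^2}{2}\hat s^2+b\hat s+\lambda(e^{\delta^2\hat s^2/2+\mu\hat s}-1)\bigr)\Bigr)}{\sqrt{2\pi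 T\Bigl(\sigma^2+\lambda\bigl((\delta^2\hat s+\mu)^2+\delta^2\bigr)e^{\delta^2\hat s^2/2+\mu\hat s}\Bigr)}}\bigl(1+O(k^{-1/2})\bigr)$$ $$=\exp\Bigl(-\frac{\sqrt2}{\delta}\,k\sqrt{\log k}+O(k)\Bigr).$$ Consequently $S_T$ has a density $f_{S_T}$ that vanishes on $(-\infty,0]$, is continuous on $(0,\infty)$, and satisfies $f_{S_T}(x)=f_{X_T}(\log x)/x$ for $x>0$ and, as $x\to\infty$, $$f_{S_T}(x)=x^{-(\sqrt2/\delta)\sqrt{\log\log x}}\cdot e^{O(\log x)}.$$ The constants in the $O$-terms may depend on $b,\sigma,\lambda,\mu,\delta,T$. -/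

import Mathlib

open MeasureTheory ProbabilityTheory Filter Asymptotics
open scoped NNReal

/-- `N` is a Poisson process with intensity `lam` under `P`: almost surely it starts at `0` and has
nondecreasing right-continuous paths, it has independent increments, and for `s ≤ t` the increment
`N t - N s` is Poisson distributed with parameter `lam * (t - s)`. -/
structure IsPoissonProcess {Ω : Type*} [MeasurableSpace Ω]
    (N : ℝ≥0 → Ω → ℕ) (lam : ℝ≥0) (P : Measure Ω) : Prop where
  zero : ∀ᵐ ω ∂P, N 0 ω = 0
  monotone_paths : ∀ᵐ ω ∂P, Monotone (fun t => N t ω)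
  rightCont_paths : ∀ᵐ ω ∂P, ∀ t, ContinuousWithinAt (fun u => N u ω) (Set.Ici t) t
  indepIncrements : HasIndepIncrements (fun t ω => (N t ω : ℤ)) P
  increments : ∀ s t : ℝ≥0, s ≤ t →
    HasLaw (fun ω => N t ω - N s ω) (poissonMeasure (lam * (t - s))) P

/-- The random inputs of the Merton jump diffusion: a standard Brownian motion `W`, a Poisson
process `N` with intensity `lam`, and i.i.d. Gaussian jump sizes `Y j` (`j = 0, 1, 2, …`) with mean
`μ` and variance `δ ^ 2`, such that `W`, `N`, `Y` are independent (as processes). -/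
structure IsMertonInput {Ω : Type*} [MeasurableSpace Ω]
    (W : ℝ≥0 → Ω → ℝ) (N : ℝ≥0 → Ω → ℕ) (Y : ℕ → Ω → ℝ)
    (lam : ℝ≥0) (μ : ℝ) (δ : ℝ≥0) (P : Measure Ω) : Prop where
  brownian : IsBrownianReal W P
  poisson : IsPoissonProcess N lam P
  jump_law : ∀ j, HasLaw (Y j) (gaussianReal μ (δ ^ 2)) P
  jump_indep : iIndepFun Y P
  indep_jumps_counts : IndepFun (fun ω t => N t ω) (fun ω j => Y j ω) P
  indep_brownian : IndepFun (fun ω t => W t ω) (fun ω => (fun t => N t ω, fun j => Y j ω)) P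

/-- The jump-diffusion log-return `X_t = b t + σ W_t + ∑_{j = 1}^{N_t} Y_j`
(the jumps are numbered from `0` here). -/
noncomputable def logReturn {Ω : Type*} (b σ : ℝ)
    (W : ℝ≥0 → Ω → ℝ) (N : ℝ≥0 → Ω → ℕ) (Y : ℕ → Ω → ℝ) (t : ℝ≥0) (ω : Ω) : ℝ :=
  b * t + σ * W t ω + ∑ j ∈ Finset.range (N t ω), Y j ω

/-- The price of the underlying, `S_t = exp X_t` (so `S_0 = 1`, and the interest rate is `0`). -/
noncomputable def spot {Ω : Type*} (b σ : ℝ)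
    (W : ℝ≥0 → Ω → ℝ) (N : ℝ≥0 → Ω → ℕ) (Y : ℕ → Ω → ℝ) (t : ℝ≥0) (ω : Ω) : ℝ :=
  Real.exp (logReturn b σ W N Y t ω)

/-- `f` is the Lebesgue density of the real random variable `X` that is continuous on `U` and
vanishes outside `U`. For open `U` there is at most one such function. -/
structure IsContinuousDensityOn {Ω : Type*} [MeasurableSpace Ω]
    (f : ℝ → ℝ) (U : Set ℝ) (X : Ω → ℝ) (P : Measure Ω) : Prop where
  nonneg : ∀ x, 0 ≤ f x
  continuousOn : ContinuousOn f U
  eq_zero : ∀ x, x ∉ U → f x = 0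
  hasLaw : HasLaw X (volume.withDensity (fun x => ENNReal.ofReal (f x))) P

/-! Given `N T = n`, the log-return is normal with mean `bT + nμ` and variance `σ²T + nδ²`. Its law
is therefore a Poisson mixture of normals (`hasLaw_logReturn`), with a positive continuous density
and an explicit entire moment generating function.

Fourier inversion along the line through `s = ŝ(k)` removes the linear phase
(`poissonGaussianPDF_eq_saddle`). Put `v = σ²T`, `d = δ²`, `a = ds + μ`, and let `A` be the jump
intensity tilted by `s`. The remaining integrand is compared with a Gaussian of curvature `m'' = v +
A(a² + d)`. For `|au| ≤ 1` a Taylor expansion gives an error of relative order `1/A`. For `|au| > 1`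
the cosine may return to `1`, but the variance of the jumps still damps the integrand by
`exp(-Ad/(4a²))`. As `A` is a constant times `exp(a²/(2d))`, both errors are `O(1/A)`
(`abs_saddle_relative_error_le`, `saddle_bound_le`), and `k ≤ C A²` turns this into `O(k^(-1/2))`.

For the logarithmic form, `log k` is `a²/(2d)` up to `O(a)`, so `ŝ = √(2d log k)/d + O(1)`
(`exists_abs_sqrt_log_sub_le`), while `m(ŝ)` and `log m''(ŝ)` are `O(A) = O(k)`. The statement on
`S_T` is the change of variables `x = e^k`. -/

/-! ### The law of the log-return. -/

/-- The law of `h N V` for a Poisson variable `N` independent of `V` is a Poisson mixture. -/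
theorem hasLaw_poisson_mixture {Ω E : Type*} [MeasurableSpace Ω] [MeasurableSpace E]
    {P : Measure Ω} [IsProbabilityMeasure P] {N : Ω → ℕ} {V : Ω → E} {r : ℝ≥0}
    (hN : HasLaw N (poissonMeasure r) P) (hV : AEMeasurable V P) (hNV : IndepFun N V P)
    {h : ℕ → E → ℝ} (hh : ∀ n, Measurable (h n)) {κ : ℕ → Measure ℝ}
    (hκ : ∀ n, HasLaw (fun ω => h n (V ω)) (κ n) P) :
    HasLaw (fun ω => h (N ω) (V ω))
      (Measure.sum fun n : ℕ =>
        ENNReal.ofReal (Real.exp (-r) * r ^ n / (n.factorial : ℝ)) • κ n) P := by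
  have hm : Measurable (fun p : ℕ × E => h p.1 p.2) := measurable_from_prod_countable_right hh
  have hNV' : AEMeasurable (fun ω => (N ω, V ω)) P := hN.aemeasurable.prodMk hV
  refine ⟨hm.comp_aemeasurable hNV', ?_⟩
  have hj := (indepFun_iff_map_prod_eq_prod_map_map hN.aemeasurable hV).1 hNV
  have e : (fun ω => h (N ω) (V ω)) = (fun p : ℕ × E => h p.1 p.2) ∘ fun ω => (N ω, V ω) := rfl
  rw [e, ← AEMeasurable.map_map_of_aemeasurable hm.aemeasurable hNV', hj, hN.map_eq]
  ext B hB
  have : IsProbabilityMeasure (P.map V) := Measure.isProbabilityMeasure_map hV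
  rw [Measure.map_apply hm hB, Measure.prod_apply (hm hB), lintegral_countable',
    Measure.sum_apply _ hB]
  congr 1
  ext n
  rw [poissonMeasure_singleton, Measure.smul_apply, smul_eq_mul, mul_comm, ← (hκ n).map_eq]
  congr 1
  rw [Measure.map_apply_of_aemeasurable (hκ n).aemeasurable hB,
    Measure.map_apply_of_aemeasurable hV (measurable_prodMk_left (hm hB))]
  rfl

theorem hasLaw_sum_range_gaussianReal {Ω : Type*} [MeasurableSpace Ω] {P : Measure Ω}
    [IsProbabilityMeasure P] {Y : ℕ → Ω → ℝ} {m : ℝ} {v : ℝ≥0}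
    (hY : ∀ j, HasLaw (Y j) (gaussianReal m v) P) (hind : iIndepFun Y P) (n : ℕ) :
    HasLaw (fun ω => ∑ j ∈ Finset.range n, Y j ω) (gaussianReal (n * m) (n * v)) P := by
  induction n with
  | zero =>
    simp only [Finset.range_zero, Finset.sum_empty, Nat.cast_zero, zero_mul, gaussianReal_zero_var]
    exact ⟨aemeasurable_const, by simp⟩
  | succ n ih =>
    have hi := hind.indepFun_finsetSum_of_notMem₀ (fun j => (hY j).aemeasurable)
      (s := Finset.range n) (i := n) (by simp)
    have hi' : IndepFun (fun ω => ∑ j ∈ Finset.range n, Y j ω) (Y n) P := by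
      convert hi using 1
      ext ω
      simp
    have := IndepFun.hasLaw_fun_add ih (hY n) hi'
    rw [gaussianReal_conv_gaussianReal] at this
    simp only [Finset.sum_range_succ]
    convert this using 2 <;> push_cast <;> ring

/-- Conditioning on the jump count needs `N` independent of the pair `(W, Y)`, whereas the model
isolates `W`. Both independence statements say that the joint law is the triple product measure, up
to reassociation and a swap. -/
theorem IndepFun.prodMk_rotate {Ω α β γ : Type*} [MeasurableSpace Ω] [MeasurableSpace α]
    [MeasurableSpace β] [MeasurableSpace γ] {P : Measure Ω} [IsProbabilityMeasure P]
    {X : Ω → α} {N : Ω → β} {V : Ω → γ} (hX : AEMeasurable X P) (hN : AEMeasurable N P)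
    (hV : AEMeasurable V P) (h : IndepFun X (fun ω => (N ω, V ω)) P) (hNV : IndepFun N V P) :
    IndepFun N (fun ω => (X ω, V ω)) P := by
  have hXV : IndepFun X V P := h.comp measurable_id measurable_snd
  rw [indepFun_iff_map_prod_eq_prod_map_map hN (hX.prodMk hV)]
  rw [indepFun_iff_map_prod_eq_prod_map_map hX (hN.prodMk hV)] at h
  rw [indepFun_iff_map_prod_eq_prod_map_map hN hV] at hNV
  rw [indepFun_iff_map_prod_eq_prod_map_map hX hV] at hXV
  have : IsProbabilityMeasure (P.map X) := Measure.isProbabilityMeasure_map hX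
  have : IsProbabilityMeasure (P.map N) := Measure.isProbabilityMeasure_map hN
  have : IsProbabilityMeasure (P.map V) := Measure.isProbabilityMeasure_map hV
  rw [hNV] at h
  rw [hXV]
  have hm : Measurable (fun p : α × β × γ => (p.2.1, (p.1, p.2.2))) := by fun_prop
  have e : (fun ω => (N ω, (X ω, V ω))) = (fun p : α × β × γ => (p.2.1, (p.1, p.2.2))) ∘
    fun ω => (X ω, (N ω, V ω)) := rfl
  rw [e, ← AEMeasurable.map_map_of_aemeasurable hm.aemeasurable (hX.prodMk (hN.prodMk hV)), h]
  have h1 := (measurePreserving_prodAssoc (P.map X) (P.map N) (P.map V)).symm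
  have h2 := (Measure.measurePreserving_swap (μ := P.map X) (ν := P.map N)).prod
    (MeasurePreserving.id (P.map V))
  have h3 := measurePreserving_prodAssoc (P.map N) (P.map X) (P.map V)
  exact (h3.comp (h2.comp h1)).map_eq

theorem hasLaw_logReturn {Ω : Type*} [MeasurableSpace Ω] {P : Measure Ω} [IsProbabilityMeasure P]
    {b μ : ℝ} {σ lam δ T : ℝ≥0} {W : ℝ≥0 → Ω → ℝ} {N : ℝ≥0 → Ω → ℕ} {Y : ℕ → Ω → ℝ}
    (hinput : IsMertonInput W N Y lam μ δ P) :
    HasLaw (logReturn b σ W N Y T)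
      (Measure.sum fun n : ℕ =>
        ENNReal.ofReal (Real.exp (-(lam * T : ℝ≥0)) * (lam * T : ℝ≥0) ^ n / (n.factorial : ℝ)) •
          gaussianReal (b * T + n * μ) (σ ^ 2 * T + n * δ ^ 2)) P := by
  have hN : HasLaw (N T) (poissonMeasure (lam * T)) P := by
    -- The process starts at `0` only almost surely, so the increment over `[0, T]` is exchanged for
    -- `N T` by a.e. congruence.
    have h := hinput.poisson.increments 0 T zero_le
    rw [tsub_zero] at h
    refine h.congr ?_
    filter_upwards [hinput.poisson.zero] with ω hω
    simp [hω]
  have hW : HasLaw (W T) (gaussianReal 0 T) P := hinput.brownian.toIsPreBrownianReal.hasLaw_eval T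
  have hY : AEMeasurable (fun ω j => Y j ω) P :=
    aemeasurable_pi_lambda _ fun j => (hinput.jump_law j).aemeasurable
  have hWNY : IndepFun (W T) (fun ω => (N T ω, fun j => Y j ω)) P :=
    hinput.indep_brownian.comp (φ := fun w : ℝ≥0 → ℝ => w T)
      (ψ := fun p : (ℝ≥0 → ℕ) × (ℕ → ℝ) => (p.1 T, p.2)) (by fun_prop) (by fun_prop)
  have hNY : IndepFun (N T) (fun ω j => Y j ω) P :=
    hinput.indep_jumps_counts.symm.symm.comp (φ := fun w : ℝ≥0 → ℕ => w T)
      (ψ := id) (by fun_prop) measurable_id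
  have hrot := IndepFun.prodMk_rotate hW.aemeasurable hN.aemeasurable hY hWNY hNY
  refine hasLaw_poisson_mixture hN (hW.aemeasurable.prodMk hY) hrot
    (h := fun n p => b * T + σ * p.1 + ∑ j ∈ Finset.range n, p.2 j) (fun n => by fun_prop) ?_
  intro n
  have hS := hasLaw_sum_range_gaussianReal hinput.jump_law hinput.jump_indep n
  have hWS : IndepFun (fun ω => b * T + σ * W T ω) (fun ω => ∑ j ∈ Finset.range n, Y j ω) P :=
    hWNY.comp (φ := fun w : ℝ => b * T + σ * w)
      (ψ := fun p : ℕ × (ℕ → ℝ) => ∑ j ∈ Finset.range n, p.2 j) (by fun_prop) (by fun_prop)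
  have h := IndepFun.hasLaw_fun_add
    (gaussianReal_const_add (gaussianReal_const_mul hW σ) (b * T)) hS hWS
  rw [gaussianReal_conv_gaussianReal] at h
  convert h using 2
  · simp only [mul_zero, zero_add]
  · congr 1

/-! ### Density and exponential moments of the mixture. -/

/-- The density of the Poisson mixture of the normal laws with means `β + n μ` and variances
`v + n d`. -/
noncomputable def poissonGaussianPDF (β μ : ℝ) (v d r : ℝ≥0) (x : ℝ) : ℝ :=
  ∑' n : ℕ, Real.exp (-r) * r ^ n / (n.factorial : ℝ) * gaussianPDFReal (β + n * μ) (v + n * d) x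

/-- The Poisson mixture of the normal laws with means `β + n μ` and variances `v + n d`. -/
noncomputable def poissonGaussian (β μ : ℝ) (v d r : ℝ≥0) : Measure ℝ :=
  Measure.sum fun n : ℕ =>
    ENNReal.ofReal (Real.exp (-r) * r ^ n / (n.factorial : ℝ)) •
      gaussianReal (β + n * μ) (v + n * d)

theorem HasSum.of_eq_fun {ι M : Type*} [AddCommMonoid M] [TopologicalSpace M] {f g : ι → M} {a : M}
    (hg : HasSum g a) (h : ∀ n, f n = g n) : HasSum f a :=
  (funext h : f = g) ▸ hg

/-- The peak of a normal density decreases with its variance. All components have variance at least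
`v > 0`, so this bound is uniform in `n` and `x` and feeds the Weierstrass M-test. -/
theorem gaussianPDFReal_le (m : ℝ) {v w : ℝ≥0} (hv : 0 < v) (hvw : v ≤ w) (x : ℝ) :
    gaussianPDFReal m w x ≤ (√(2 * Real.pi * v))⁻¹ := by
  rw [gaussianPDFReal]
  have h1 : Real.exp (-(x - m) ^ 2 / (2 * w)) ≤ 1 := by
    rw [Real.exp_le_one_iff]
    exact div_nonpos_of_nonpos_of_nonneg (neg_nonpos.2 (sq_nonneg _)) (by positivity)
  have hv' : (0 : ℝ) < v := hv
  have h2 : (√(2 * Real.pi * w))⁻¹ ≤ (√(2 * Real.pi * v))⁻¹ := by gcongr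
  calc _ ≤ (√(2 * Real.pi * v))⁻¹ * 1 := by gcongr
    _ = _ := mul_one _

section

variable (β μ : ℝ) {v : ℝ≥0} (d r : ℝ≥0)

theorem poissonGaussianPDF_term_nonneg (v : ℝ≥0) (n : ℕ) (x : ℝ) :
    0 ≤ Real.exp (-r) * r ^ n / (n.factorial : ℝ) *
      gaussianPDFReal (β + n * μ) (v + n * d) x :=
  mul_nonneg (by positivity) (gaussianPDFReal_nonneg _ _ _)

theorem poissonGaussianPDF_term_le (hv : 0 < v) (n : ℕ) (x : ℝ) :
    Real.exp (-r) * r ^ n / (n.factorial : ℝ) *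
      gaussianPDFReal (β + n * μ) (v + n * d) x ≤
      Real.exp (-r) * r ^ n / (n.factorial : ℝ) * (√(2 * Real.pi * v))⁻¹ :=
  mul_le_mul_of_nonneg_left (gaussianPDFReal_le _ hv (by simp) x) (by positivity)

theorem poissonGaussianPDF_summable (hv : 0 < v) (x : ℝ) :
    Summable fun n : ℕ => Real.exp (-r) * r ^ n / (n.factorial : ℝ) *
      gaussianPDFReal (β + n * μ) (v + n * d) x :=
  Summable.of_nonneg_of_le (fun n => poissonGaussianPDF_term_nonneg β μ d r v n x)
    (fun n => poissonGaussianPDF_term_le β μ d r hv n x)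
    ((hasSum_one_poissonMeasure r).summable.mul_right _)

theorem poissonGaussianPDF_continuous (hv : 0 < v) :
    Continuous (poissonGaussianPDF β μ v d r) := by
  refine continuous_tsum (fun n => ?_)
    ((hasSum_one_poissonMeasure r).summable.mul_right ((√(2 * Real.pi * v))⁻¹)) ?_
  · simp only [gaussianPDFReal]
    fun_prop
  · intro n x
    rw [Real.norm_of_nonneg (poissonGaussianPDF_term_nonneg β μ d r v n x)]
    exact poissonGaussianPDF_term_le β μ d r hv n x

theorem poissonGaussianPDF_pos (hv : 0 < v) (x : ℝ) : 0 < poissonGaussianPDF β μ v d r x :=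
  (poissonGaussianPDF_summable β μ d r hv x).tsum_pos
    (fun n => poissonGaussianPDF_term_nonneg β μ d r v n x) 0
    (mul_pos (by positivity) (gaussianPDFReal_pos _ _ _ (by simpa using hv.ne')))

theorem poissonGaussian_eq_withDensity (hv : 0 < v) :
    poissonGaussian β μ v d r =
      volume.withDensity fun x => ENNReal.ofReal (poissonGaussianPDF β μ v d r x) := by
  ext B hB
  have hne : ∀ n : ℕ, v + n * d ≠ 0 := fun n => (lt_of_lt_of_le hv (by simp)).ne'
  rw [poissonGaussian, Measure.sum_apply _ hB, withDensity_apply _ hB]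
  have e : ∀ x, ENNReal.ofReal (poissonGaussianPDF β μ v d r x) =
      ∑' n : ℕ, ENNReal.ofReal (Real.exp (-r) * r ^ n / (n.factorial : ℝ)) *
        gaussianPDF (β + n * μ) (v + n * d) x := by
    intro x
    rw [poissonGaussianPDF, ENNReal.ofReal_tsum_of_nonneg
      (fun n => poissonGaussianPDF_term_nonneg β μ d r v n x)
      (poissonGaussianPDF_summable β μ d r hv x)]
    congr 1
    ext n
    rw [ENNReal.ofReal_mul (by positivity), gaussianPDF]
  simp only [e]
  rw [lintegral_tsum fun n => ((measurable_gaussianPDF _ _).const_mul _).aemeasurable]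
  congr 1
  ext n
  rw [lintegral_const_mul _ (measurable_gaussianPDF _ _), Measure.smul_apply, smul_eq_mul,
    gaussianReal_apply _ (hne n)]

theorem lintegral_exp_mul_gaussianReal (m : ℝ) (w : ℝ≥0) (s : ℝ) :
    ∫⁻ x, ENNReal.ofReal (Real.exp (s * x)) ∂gaussianReal m w =
      ENNReal.ofReal (Real.exp (m * s + w * s ^ 2 / 2)) := by
  rw [← ofReal_integral_eq_lintegral_ofReal (integrable_exp_mul_gaussianReal s)
    (ae_of_all _ fun x => (Real.exp_pos _).le)]
  congr 1
  exact congrFun mgf_id_gaussianReal s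

/-- The exponent is affine in `n`, so the series is an exponential series. -/
theorem hasSum_poissonGaussian_mgf (v : ℝ≥0) (s : ℝ) :
    HasSum (fun n : ℕ => Real.exp (-r) * r ^ n / (n.factorial : ℝ) *
        Real.exp ((β + n * μ) * s + ((v + n * d : ℝ≥0) : ℝ) * s ^ 2 / 2))
      (Real.exp (β * s + v * s ^ 2 / 2 + r * (Real.exp (d * s ^ 2 / 2 + μ * s) - 1))) := by
  have h := (NormedSpace.expSeries_div_hasSum_exp (r * Real.exp (d * s ^ 2 / 2 + μ * s))).mul_left
    (Real.exp (-r) * Real.exp (β * s + v * s ^ 2 / 2))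
  rw [← Real.exp_eq_exp_ℝ, ← Real.exp_add, ← Real.exp_add] at h
  have e : β * s + v * s ^ 2 / 2 + r * (Real.exp (d * s ^ 2 / 2 + μ * s) - 1) =
      -r + (β * s + v * s ^ 2 / 2) + r * Real.exp (d * s ^ 2 / 2 + μ * s) := by ring
  rw [e]
  refine HasSum.of_eq_fun h fun n => ?_
  rw [mul_pow, ← Real.exp_nat_mul]
  have : ((β + n * μ) * s + ((v + n * d : ℝ≥0) : ℝ) * s ^ 2 / 2) =
    (β * s + v * s ^ 2 / 2) + n * (d * s ^ 2 / 2 + μ * s) := by push_cast; ring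
  simp only [this, Real.exp_add]
  ring

theorem lintegral_exp_mul_poissonGaussian (v : ℝ≥0) (s : ℝ) :
    ∫⁻ x, ENNReal.ofReal (Real.exp (s * x)) ∂poissonGaussian β μ v d r =
      ENNReal.ofReal (Real.exp (β * s + v * s ^ 2 / 2 +
        r * (Real.exp (d * s ^ 2 / 2 + μ * s) - 1))) := by
  have h := hasSum_poissonGaussian_mgf β μ d r v s
  rw [poissonGaussian, lintegral_sum_measure, ← h.tsum_eq,
    ENNReal.ofReal_tsum_of_nonneg (fun n => by positivity) h.summable]
  congr 1
  ext n
  rw [lintegral_smul_measure, lintegral_exp_mul_gaussianReal, ENNReal.ofReal_mul (by positivity),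
    smul_eq_mul]

variable {β μ} {d r} {Ω : Type*} [MeasurableSpace Ω] {P : Measure Ω} {X : Ω → ℝ}

theorem ProbabilityTheory.HasLaw.lintegral_exp_mul_poissonGaussian (hX : HasLaw X (poissonGaussian β μ v d r) P)
    (s : ℝ) :
    ∫⁻ ω, ENNReal.ofReal (Real.exp (s * X ω)) ∂P =
      ENNReal.ofReal (Real.exp (β * s + v * s ^ 2 / 2 +
        r * (Real.exp (d * s ^ 2 / 2 + μ * s) - 1))) := by
  rw [← _root_.lintegral_exp_mul_poissonGaussian, ← hX.map_eq,
    lintegral_map' (by fun_prop) hX.aemeasurable]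

theorem ProbabilityTheory.HasLaw.integrable_exp_mul_poissonGaussian (hX : HasLaw X (poissonGaussian β μ v d r) P)
    (s : ℝ) : Integrable (fun ω => Real.exp (s * X ω)) P := by
  refine ⟨?_, ?_⟩
  · have := hX.aemeasurable
    exact (by fun_prop : AEMeasurable (fun ω => Real.exp (s * X ω)) P).aestronglyMeasurable
  · rw [hasFiniteIntegral_iff_ofReal (ae_of_all _ fun x => (Real.exp_pos _).le),
      hX.lintegral_exp_mul_poissonGaussian]
    exact ENNReal.ofReal_lt_top

theorem ProbabilityTheory.HasLaw.mgf_poissonGaussian (hX : HasLaw X (poissonGaussian β μ v d r) P) (s : ℝ) :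
    mgf X P s = Real.exp (β * s + v * s ^ 2 / 2 +
        r * (Real.exp (d * s ^ 2 / 2 + μ * s) - 1)) := by
  rw [mgf, integral_eq_lintegral_of_nonneg_ae (ae_of_all _ fun x => (Real.exp_pos _).le)
    (hX.integrable_exp_mul_poissonGaussian s).aestronglyMeasurable,
    hX.lintegral_exp_mul_poissonGaussian, ENNReal.toReal_ofReal (Real.exp_pos _).le]

end

/-! ### Fourier inversion along a vertical line. -/

/-- Fourier representation of the normal density along the vertical line through `s`. -/
theorem integral_cexp_gaussian_vertical (m k s : ℝ) {w : ℝ≥0} (hw : 0 < w) :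
    ∫ u : ℝ, Complex.exp ((s + u * Complex.I) * m + w * (s + u * Complex.I) ^ 2 / 2 -
        (s + u * Complex.I) * k) = ((2 * Real.pi * gaussianPDFReal m w k : ℝ) : ℂ) := by
  have hw' : (0 : ℝ) < w := hw
  have hwc : ((w : ℝ) : ℂ) ≠ 0 := by exact_mod_cast hw'.ne'
  have hb : (-(((w : ℝ) : ℂ) / 2)).re < 0 := by
    rw [Complex.neg_re, Complex.div_ofNat_re, Complex.ofReal_re]
    linarith
  have h := integral_cexp_quadratic hb (Complex.I * (m + s * w - k))
    (s * (m - k) + s ^ 2 * w / 2)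
  have e : ∀ u : ℝ, (s + u * Complex.I) * m + w * (s + u * Complex.I) ^ 2 / 2 -
      (s + u * Complex.I) * k = -(((w : ℝ) : ℂ) / 2) * u ^ 2 +
        Complex.I * (m + s * w - k) * u + (s * (m - k) + s ^ 2 * w / 2) := by
    intro u
    linear_combination (w * u ^ 2 / 2 : ℂ) * Complex.I_sq
  simp only [e]
  rw [h]
  have e1 : ((s : ℂ) * (m - k) + s ^ 2 * w / 2) -
      (Complex.I * (m + s * w - k)) ^ 2 / (4 * -(((w : ℝ) : ℂ) / 2)) =
      ((-(k - m) ^ 2 / (2 * w) : ℝ) : ℂ) := by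
    push_cast
    rw [mul_pow, Complex.I_sq]
    field_simp
    ring
  have e2 : ((Real.pi : ℂ) / - -(((w : ℝ) : ℂ) / 2)) = ((2 * Real.pi / w : ℝ) : ℂ) := by
    push_cast
    field_simp
  have e3 : ((2 * Real.pi / w : ℝ) : ℂ) ^ (1 / 2 : ℂ) = ((√(2 * Real.pi / w) : ℝ) : ℂ) := by
    rw [Real.sqrt_eq_rpow, Complex.ofReal_cpow (by positivity)]
    norm_num
  rw [e1, e2, e3, ← Complex.ofReal_exp, ← Complex.ofReal_mul, gaussianPDFReal]
  congr 1
  have e4 : √(2 * Real.pi / w) = 2 * Real.pi * (√(2 * Real.pi * w))⁻¹ := by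
    rw [← Real.sqrt_inv, ← Real.sqrt_sq (by positivity : 0 ≤ 2 * Real.pi),
      ← Real.sqrt_mul (by positivity)]
    congr 1
    rw [Real.sqrt_sq (by positivity)]
    field_simp
  rw [e4]
  ring

theorem norm_cexp_gaussian_vertical (m k s : ℝ) (w : ℝ≥0) (u : ℝ) :
    ‖Complex.exp ((s + u * Complex.I) * m + w * (s + u * Complex.I) ^ 2 / 2 -
        (s + u * Complex.I) * k)‖ =
      Real.exp (m * s + w * s ^ 2 / 2) * Real.exp (-s * k) * Real.exp (-(w / 2 : ℝ) * u ^ 2) := by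
  rw [Complex.norm_exp, ← Real.exp_add, ← Real.exp_add]
  congr 1
  simp [pow_two]
  ring

theorem integrable_cexp_gaussian_vertical (m k s : ℝ) {w : ℝ≥0} (hw : 0 < w) :
    Integrable fun u : ℝ => Complex.exp ((s + u * Complex.I) * m +
      w * (s + u * Complex.I) ^ 2 / 2 - (s + u * Complex.I) * k) := by
  have hw' : (0 : ℝ) < w := hw
  rw [← integrable_norm_iff (by fun_prop)]
  simp only [norm_cexp_gaussian_vertical]
  exact (integrable_exp_neg_mul_sq (by positivity)).const_mul _

section

variable (β μ : ℝ) {v : ℝ≥0} (d r : ℝ≥0)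

/-- Fourier inversion for the Poisson–Gaussian mixture along the vertical line through `s`. -/
theorem integral_cexp_poissonGaussian (hv : 0 < v) (k s : ℝ) :
    ∫ u : ℝ, Complex.exp (β * (s + u * Complex.I) +
        v * (s + u * Complex.I) ^ 2 / 2 + r * (Complex.exp (d * (s + u * Complex.I) ^ 2 / 2 +
          μ * (s + u * Complex.I)) - 1) - (s + u * Complex.I) * k) =
      ((2 * Real.pi * poissonGaussianPDF β μ v d r k : ℝ) : ℂ) := by
  have hv' : (0 : ℝ) < v := hv
  have hpos : ∀ n : ℕ, 0 < v + n * d := fun n => lt_of_lt_of_le hv (by simp)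
  set c : ℕ → ℝ := fun n => Real.exp (-r) * r ^ n / (n.factorial : ℝ) with hc
  set F : ℕ → ℝ → ℂ := fun n u => (c n : ℂ) *
    Complex.exp ((s + u * Complex.I) * ((β + n * μ : ℝ) : ℂ) +
      (((v + n * d : ℝ≥0) : ℝ) : ℂ) * (s + u * Complex.I) ^ 2 / 2 - (s + u * Complex.I) * k) with hF
  have hc0 : ∀ n, 0 ≤ c n := fun n => by positivity
  have hFi : ∀ n, Integrable (F n) := fun n =>
    (integrable_cexp_gaussian_vertical _ k s (hpos n)).const_mul _
  have hnorm : ∀ n u, ‖F n u‖ = c n * (Real.exp ((β + n * μ) * s +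
      ((v + n * d : ℝ≥0) : ℝ) * s ^ 2 / 2) * Real.exp (-s * k) *
        Real.exp (-(((v + n * d : ℝ≥0) : ℝ) / 2) * u ^ 2)) := by
    intro n u
    rw [hF]
    simp only
    rw [norm_mul, norm_cexp_gaussian_vertical, Complex.norm_real, Real.norm_of_nonneg (hc0 n)]
  -- Bounding every variance below by `v` in the Gaussian integrals leaves the convergent series of
  -- the moment generating function at the real point `s`; this justifies exchanging sum and
  -- integral.
  have hsum : Summable fun n => ∫ u, ‖F n u‖ := by
    refine Summable.of_nonneg_of_le (fun n => integral_nonneg fun u => norm_nonneg _) (fun n => ?_)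
      ((hasSum_poissonGaussian_mgf β μ d r v s).summable.mul_right
        (Real.exp (-s * k) * √(Real.pi / (v / 2))))
    simp only [hnorm]
    rw [integral_const_mul, integral_const_mul, integral_gaussian, ← mul_assoc, ← mul_assoc,
      mul_assoc]
    have : √(Real.pi / (((v + n * d : ℝ≥0) : ℝ) / 2)) ≤ √(Real.pi / (v / 2)) := by
      gcongr
      simp
    gcongr
  have hpt : ∀ u : ℝ, HasSum (fun n => F n u) (Complex.exp (β * (s + u * Complex.I) +
        v * (s + u * Complex.I) ^ 2 / 2 + r * (Complex.exp (d * (s + u * Complex.I) ^ 2 / 2 +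
          μ * (s + u * Complex.I)) - 1) - (s + u * Complex.I) * k)) := by
    intro u
    set z : ℂ := s + u * Complex.I
    have h := (NormedSpace.expSeries_div_hasSum_exp
      ((r : ℂ) * Complex.exp (d * z ^ 2 / 2 + μ * z))).mul_left
      (Complex.exp (-r) * Complex.exp (β * z + v * z ^ 2 / 2 - z * k))
    rw [← Complex.exp_eq_exp_ℂ, ← Complex.exp_add, ← Complex.exp_add] at h
    have e : β * z + v * z ^ 2 / 2 + r * (Complex.exp (d * z ^ 2 / 2 + μ * z) - 1) - z * k =
      -r + (β * z + v * z ^ 2 / 2 - z * k) + r * Complex.exp (d * z ^ 2 / 2 + μ * z) := by ring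
    rw [e]
    refine HasSum.of_eq_fun h fun n => ?_
    rw [mul_pow, ← Complex.exp_nat_mul]
    have e1 : z * ((β + n * μ : ℝ) : ℂ) + (((v + n * d : ℝ≥0) : ℝ) : ℂ) * z ^ 2 / 2 - z * k =
      (β * z + v * z ^ 2 / 2 - z * k) + n * (d * z ^ 2 / 2 + μ * z) := by push_cast; ring
    have e2 : (c n : ℂ) = Complex.exp (-r) * r ^ n / (n.factorial : ℂ) := by
      rw [hc]; push_cast; rfl
    rw [hF]
    simp only
    rw [e1, e2]
    simp only [sub_eq_add_neg, Complex.exp_add]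
    ring
  have hint := hasSum_integral_of_summable_integral_norm hFi hsum
  have etsum : (fun u => ∑' n, F n u) = _ := funext fun u => (hpt u).tsum_eq
  rw [etsum] at hint
  have e : ∀ n, ∫ u, F n u = ((2 * Real.pi * (c n * gaussianPDFReal (β + n * μ)
      (v + n * d) k) : ℝ) : ℂ) := by
    intro n
    rw [hF]
    simp only
    rw [integral_const_mul, integral_cexp_gaussian_vertical _ k s (hpos n)]
    push_cast
    ring
  simp only [e] at hint
  have h2 := (poissonGaussianPDF_summable β μ d r hv k).hasSum.mul_left (2 * Real.pi)
  exact hint.unique (Complex.hasSum_ofReal.2 h2)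

/-- The real part of the exponent after shifting the contour to the saddle point. -/
noncomputable def saddleRe (v d A a u : ℝ) : ℝ :=
  -(v / 2) * u ^ 2 + A * (Real.exp (-(d / 2) * u ^ 2) * Real.cos (a * u) - 1)

/-- The imaginary part of the exponent after shifting the contour to the saddle point. -/
noncomputable def saddleIm (d A a u : ℝ) : ℝ :=
  A * (Real.exp (-(d / 2) * u ^ 2) * Real.sin (a * u) - a * u)

/-- The saddle point equation `hk` replaces `k` in the phase `-uk`, which cancels the drift and
diffusion terms and leaves the jump phase minus its linear part. The density is real, so taking real
parts loses nothing. -/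
theorem poissonGaussianPDF_eq_saddle (hv : 0 < v) {k s : ℝ}
    (hk : k = β + v * s + r * Real.exp (d * s ^ 2 / 2 + μ * s) * (d * s + μ)) :
    2 * Real.pi * poissonGaussianPDF β μ v d r k =
      Real.exp (β * s + v * s ^ 2 / 2 + r * (Real.exp (d * s ^ 2 / 2 + μ * s) - 1) - s * k) *
        ∫ u, Real.exp (saddleRe v d (r * Real.exp (d * s ^ 2 / 2 + μ * s)) (d * s + μ) u) *
          Real.cos (saddleIm d (r * Real.exp (d * s ^ 2 / 2 + μ * s)) (d * s + μ) u) := by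
  have h := integral_cexp_poissonGaussian β μ d r hv k s
  set E := Real.exp (d * s ^ 2 / 2 + μ * s) with hE
  have hne : ((2 * Real.pi * poissonGaussianPDF β μ v d r k : ℝ) : ℂ) ≠ 0 := by
    have := poissonGaussianPDF_pos β μ d r hv k
    exact_mod_cast (by positivity : 2 * Real.pi * poissonGaussianPDF β μ v d r k ≠ 0)
  -- A non-integrable function has integral `0` by convention, so positivity of the density already
  -- yields integrability.
  have hint := Integrable.of_integral_ne_zero (h ▸ hne)
  have h2 := integral_re hint
  rw [h] at h2
  rw [← integral_const_mul]
  refine h2.symm.trans ?_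
  congr 1
  ext u
  have e1 : Complex.exp (d * (s + u * Complex.I) ^ 2 / 2 + μ * (s + u * Complex.I)) =
      (E : ℂ) * Complex.exp (((-(d / 2) * u ^ 2 : ℝ) : ℂ) + (((d * s + μ) * u : ℝ) : ℂ) *
        Complex.I) := by
    rw [hE, Complex.ofReal_exp, ← Complex.exp_add]
    congr 1
    push_cast
    linear_combination (d * u ^ 2 / 2 : ℂ) * Complex.I_sq
  rw [e1]
  simp only [RCLike.re_eq_complex_re, Complex.exp_re]
  rw [← mul_assoc, ← Real.exp_add]
  congr 1
  · congr 1
    simp [Complex.exp_re, Complex.exp_im, pow_two, saddleRe]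
    ring
  · congr 1
    simp [Complex.exp_re, Complex.exp_im, pow_two, saddleIm, hk]
    ring

end

/-! ### Laplace approximation of the saddle point integral. -/

/-- On `(-∞, M]` the exponential is Lipschitz with constant `exp M`; the phase costs only `1 - cos y
≤ y²/2`. -/
theorem abs_exp_mul_cos_sub_exp_le {x y z M : ℝ} (hx : x ≤ M) (hz : z ≤ M) :
    |Real.exp x * Real.cos y - Real.exp z| ≤ Real.exp M * (|x - z| + y ^ 2 / 2) := by
  have h1 : |Real.exp x - Real.exp z| ≤ Real.exp M * |x - z| := by
    have key : ∀ p q : ℝ, p ≤ M → Real.exp p - Real.exp q ≤ Real.exp M * |p - q| := by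
      intro p q hp
      have e : Real.exp q = Real.exp p * Real.exp (q - p) := by rw [← Real.exp_add]; ring_nf
      have h := Real.add_one_le_exp (q - p)
      calc Real.exp p - Real.exp q = Real.exp p * (1 - Real.exp (q - p)) := by rw [e]; ring
        _ ≤ Real.exp p * |p - q| :=
          mul_le_mul_of_nonneg_left (by linarith [le_abs_self (p - q)]) (Real.exp_pos _).le
        _ ≤ _ := by gcongr
    rw [abs_le]
    refine ⟨?_, key x z hx⟩
    have := key z x hz
    rw [abs_sub_comm] at this
    linarith
  have h2 : |Real.exp x * (1 - Real.cos y)| ≤ Real.exp M * (y ^ 2 / 2) := by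
    rw [abs_mul, abs_of_pos (Real.exp_pos _), abs_of_nonneg (by linarith [Real.cos_le_one y])]
    have := Real.one_sub_sq_div_two_le_cos (x := y)
    exact mul_le_mul (Real.exp_le_exp.2 hx) (by linarith) (by linarith [Real.cos_le_one y])
      (Real.exp_pos _).le
  calc |Real.exp x * Real.cos y - Real.exp z|
      = |(Real.exp x - Real.exp z) - Real.exp x * (1 - Real.cos y)| := by congr 1; ring
    _ ≤ |Real.exp x - Real.exp z| + |Real.exp x * (1 - Real.cos y)| := abs_sub _ _
    _ ≤ _ := by linarith

/-- Follows from `exp x ≥ 1 + x + x²/2` and `(1 - x + x²/2)(1 + x + x²/2) = 1 + x⁴/4`. -/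
theorem exp_neg_le_quadratic {x : ℝ} (hx : 0 ≤ x) : Real.exp (-x) ≤ 1 - x + x ^ 2 / 2 := by
  have h := Real.quadratic_le_exp_of_nonneg hx
  rw [Real.exp_neg, inv_le_comm₀ (Real.exp_pos _) (by nlinarith [sq_nonneg (x - 1)])]
  refine le_trans ?_ h
  rw [inv_le_iff_one_le_mul₀ (by nlinarith [sq_nonneg (x - 1)])]
  nlinarith [sq_nonneg (x ^ 2)]

/-- Here `w = au` and `q = d/a²`, so the damping factor is that of one tilted jump. The three error
terms contribute at most `5/96`, `1/8` and `1/4` times `w⁴`. -/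
theorem abs_exp_mul_cos_taylor {q w : ℝ} (hq0 : 0 ≤ q) (hq1 : q ≤ 1) (hw : |w| ≤ 1) :
    |Real.exp (-(q / 2 * w ^ 2)) * Real.cos w - 1 + (1 + q) * w ^ 2 / 2| ≤ w ^ 4 := by
  set x := q / 2 * w ^ 2 with hx
  have hx0 : 0 ≤ x := by positivity
  have hxw : x ≤ w ^ 2 / 2 := by nlinarith [sq_nonneg w]
  have h1 := exp_neg_le_quadratic hx0
  have h2 := Real.add_one_le_exp (-x)
  have h3 : Real.exp (-x) ≤ 1 := Real.exp_le_one_iff.2 (by linarith)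
  have hc := abs_le.1 (Real.cos_bound hw)
  have h4 : |w| ^ 4 = w ^ 4 := by rw [← abs_pow, abs_of_nonneg (by positivity)]
  rw [h4] at hc
  have hx2 : x ^ 2 ≤ w ^ 4 / 4 := by nlinarith
  have hxw2 : x * w ^ 2 ≤ w ^ 4 / 2 := by nlinarith [sq_nonneg w]
  have e : Real.exp (-x) * Real.cos w - 1 + (1 + q) * w ^ 2 / 2 =
      Real.exp (-x) * (Real.cos w - (1 - w ^ 2 / 2)) + (Real.exp (-x) - 1 + x) +
        (1 - Real.exp (-x)) * (w ^ 2 / 2) := by rw [hx]; ring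
  have hp : 0 < Real.exp (-x) := Real.exp_pos _
  have hw4 : 0 ≤ w ^ 4 := by positivity
  have b1 : |Real.exp (-x) * (Real.cos w - (1 - w ^ 2 / 2))| ≤ w ^ 4 * (5 / 96) := by
    rw [abs_mul, abs_of_pos hp]
    calc _ ≤ 1 * (w ^ 4 * (5 / 96)) := by
          gcongr
          exact abs_le.2 hc
      _ = _ := one_mul _
  have b1' := abs_le.1 b1
  have b2 : 0 ≤ (1 - Real.exp (-x)) * (w ^ 2 / 2) := by
    have : 0 ≤ 1 - Real.exp (-x) := by linarith
    positivity
  have b3 : (1 - Real.exp (-x)) * (w ^ 2 / 2) ≤ x * (w ^ 2 / 2) := by gcongr; linarith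
  rw [e, abs_le]
  constructor <;> linarith

theorem abs_exp_mul_sin_taylor {q w : ℝ} (hq0 : 0 ≤ q) (hq1 : q ≤ 1) (hw : |w| ≤ 1) :
    |Real.exp (-(q / 2 * w ^ 2)) * Real.sin w - w| ≤ |w| ^ 3 := by
  set x := q / 2 * w ^ 2 with hx
  have hx0 : 0 ≤ x := by positivity
  have hxw : x ≤ w ^ 2 / 2 := by nlinarith [sq_nonneg w]
  have h2 := Real.add_one_le_exp (-x)
  have h3 : Real.exp (-x) ≤ 1 := Real.exp_le_one_iff.2 (by linarith)
  have hp : 0 < Real.exp (-x) := Real.exp_pos _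
  have hs : |Real.sin w - w| ≤ |w| ^ 3 / 4 := by
    have key : ∀ t : ℝ, 0 ≤ t → t ≤ 1 → |Real.sin t - t| ≤ t ^ 3 / 4 := by
      intro t h0 h1
      have := Real.sin_le h0
      rcases h0.eq_or_lt with rfl | h
      · simp
      · have := Real.sin_gt_sub_cube h
        have : 0 ≤ t ^ 3 := by positivity
        rw [abs_le]; constructor <;> linarith
    rcases le_total 0 w with h | h
    · rw [abs_of_nonneg h] at hw ⊢; exact key w h hw
    · rw [abs_of_nonpos h] at hw ⊢
      have := key (-w) (by linarith) hw
      rw [Real.sin_neg, ← abs_neg] at this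
      convert this using 2; ring
  have e : Real.exp (-x) * Real.sin w - w =
      Real.exp (-x) * (Real.sin w - w) - (1 - Real.exp (-x)) * w := by ring
  have b1 : |Real.exp (-x) * (Real.sin w - w)| ≤ |w| ^ 3 / 4 := by
    rw [abs_mul, abs_of_pos hp]
    calc _ ≤ 1 * (|w| ^ 3 / 4) := by gcongr
      _ = _ := one_mul _
  have b2 : |(1 - Real.exp (-x)) * w| ≤ |w| ^ 3 / 2 := by
    rw [abs_mul, abs_of_nonneg (by linarith)]
    calc _ ≤ (|w| ^ 2 / 2) * |w| := by gcongr; rw [sq_abs]; linarith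
      _ = _ := by ring
  rw [e]
  refine (abs_sub _ _).trans ?_
  have : 0 ≤ |w| ^ 3 := by positivity
  linarith

/-- Half of the decay absorbs the polynomial: `t² ≤ 200 exp(t/10)` and `t³/2 ≤ 3000 exp(t/10)`. -/
theorem exp_neg_mul_cubic_le {t : ℝ} (ht : 0 ≤ t) :
    Real.exp (-(t / 5)) * (t ^ 2 + t ^ 3 / 2) ≤ 3200 * Real.exp (-(t / 10)) := by
  have h2 := Real.pow_div_factorial_le_exp (t / 10) (by positivity) 2
  have h3 := Real.pow_div_factorial_le_exp (t / 10) (by positivity) 3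
  norm_num [Nat.factorial] at h2 h3
  have hpoly : t ^ 2 + t ^ 3 / 2 ≤ 3200 * Real.exp (t / 10) := by linarith
  have e : Real.exp (-(t / 10)) = Real.exp (-(t / 5)) * Real.exp (t / 10) := by
    rw [← Real.exp_add]; ring_nf
  calc _ ≤ Real.exp (-(t / 5)) * (3200 * Real.exp (t / 10)) := by gcongr
    _ = _ := by rw [e]; ring

theorem cos_le_one_sub_sq_div_five {w : ℝ} (h : |w| ≤ 1) : Real.cos w ≤ 1 - w ^ 2 / 5 := by
  have h1 := Real.cos_le_one_sub_mul_cos_sq (h.trans (by linarith [Real.pi_gt_three]))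
  have hpi : Real.pi ^ 2 ≤ 10 := by nlinarith [Real.pi_lt_d2, Real.pi_gt_three]
  have h2 : 1 / 5 ≤ 2 / Real.pi ^ 2 := by
    rw [div_le_div_iff₀ (by norm_num) (by positivity)]; linarith
  have h3 := mul_le_mul_of_nonneg_right h2 (sq_nonneg w)
  linarith

/-- Both exponents lie below `-t/5` with `t = Aw²`. They differ by at most `Aw⁴ = t²/A`, and half
the squared phase is at most `A²w⁶/2 = t³/(2A)`. -/
theorem abs_saddle_sub_gaussian_le_of_small {V A q w : ℝ} (hV : 0 ≤ V) (hA : 0 < A)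
    (hq0 : 0 ≤ q) (hq1 : q ≤ 1) (h : |w| ≤ 1) :
    |Real.exp (-V + A * (Real.exp (-(q / 2 * w ^ 2)) * Real.cos w - 1)) *
        Real.cos (A * (Real.exp (-(q / 2 * w ^ 2)) * Real.sin w - w)) -
          Real.exp (-V - A * ((1 + q) * w ^ 2 / 2))| ≤
      3200 / A * Real.exp (-(A * w ^ 2 / 10)) := by
  have hc := abs_exp_mul_cos_taylor hq0 hq1 h
  have hs := abs_exp_mul_sin_taylor hq0 hq1 h
  have hexp1 : Real.exp (-(q / 2 * w ^ 2)) ≤ 1 := Real.exp_le_one_iff.2 (by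
    rw [neg_nonpos]; positivity)
  generalize Real.exp (-(q / 2 * w ^ 2)) = e at hc hs hexp1 ⊢
  have hcos := cos_le_one_sub_sq_div_five h
  have hcos0 : 0 ≤ Real.cos w := by
    have := Real.one_sub_sq_div_two_le_cos (x := w)
    have h2 : w ^ 2 ≤ 1 := (sq_le_one_iff_abs_le_one w).2 h
    linarith
  have hAw : 0 ≤ A * w ^ 2 := by positivity
  have hM1 : -V + A * (e * Real.cos w - 1) ≤ -(A * w ^ 2 / 5) := by
    have h1 : e * Real.cos w ≤ 1 * Real.cos w := by gcongr
    have h2 : A * (e * Real.cos w - 1) ≤ A * (-(w ^ 2 / 5)) := by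
      gcongr; linarith
    linarith
  have hM2 : -V - A * ((1 + q) * w ^ 2 / 2) ≤ -(A * w ^ 2 / 5) := by
    have : 0 ≤ A * q * w ^ 2 := by positivity
    linarith
  refine (abs_exp_mul_cos_sub_exp_le hM1 hM2).trans ?_
  have e1 : -V + A * (e * Real.cos w - 1) - (-V - A * ((1 + q) * w ^ 2 / 2)) =
      A * (e * Real.cos w - 1 + (1 + q) * w ^ 2 / 2) := by ring
  rw [e1, abs_mul, abs_of_pos hA]
  have h6 : (e * Real.sin w - w) ^ 2 ≤ w ^ 6 := by
    have e6 : w ^ 6 = (|w| ^ 3) ^ 2 := by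
      rw [← pow_mul, mul_comm, pow_mul, sq_abs, ← pow_mul]
    rw [← sq_abs, e6]
    gcongr
  have hb : A * |e * Real.cos w - 1 + (1 + q) * w ^ 2 / 2| + (A * (e * Real.sin w - w)) ^ 2 / 2 ≤
      ((A * w ^ 2) ^ 2 + (A * w ^ 2) ^ 3 / 2) / A := by
    have e2 : ((A * w ^ 2) ^ 2 + (A * w ^ 2) ^ 3 / 2) / A = A * w ^ 4 + A ^ 2 * w ^ 6 / 2 := by
      field_simp
    rw [e2, mul_pow]
    have h7 := mul_le_mul_of_nonneg_left h6 (sq_nonneg A)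
    have h8 := mul_le_mul_of_nonneg_left hc hA.le
    linarith
  have h9 := exp_neg_mul_cubic_le hAw
  calc _ ≤ Real.exp (-(A * w ^ 2 / 5)) * (((A * w ^ 2) ^ 2 + (A * w ^ 2) ^ 3 / 2) / A) :=
        mul_le_mul_of_nonneg_left hb (Real.exp_pos _).le
    _ = Real.exp (-(A * w ^ 2 / 5)) * ((A * w ^ 2) ^ 2 + (A * w ^ 2) ^ 3 / 2) / A := by ring
    _ ≤ 3200 * Real.exp (-(A * w ^ 2 / 10)) / A := by gcongr
    _ = _ := by ring

/-- The two terms are bounded separately, and the phase `y` is irrelevant. Near multiples of `2π`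
the cosine gives no decay; only the factor `exp(-q/2) ≤ 1 - q/4` does. -/
theorem abs_saddle_sub_gaussian_le_of_large {V A q w : ℝ} (y : ℝ) (hV : 0 ≤ V) (hA : 0 < A)
    (hq0 : 0 ≤ q) (hq1 : q ≤ 1) (h : 1 < |w|) :
    |Real.exp (-V + A * (Real.exp (-(q / 2 * w ^ 2)) * Real.cos w - 1)) * Real.cos y -
          Real.exp (-V - A * ((1 + q) * w ^ 2 / 2))| ≤
      3200 / A * Real.exp (-(A * w ^ 2 / 10)) + Real.exp (-(A * q / 4)) * Real.exp (-V) := by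
  have hw1 : 1 ≤ w ^ 2 := (one_le_sq_iff_one_le_abs w).2 h.le
  have hAqw : 0 ≤ A * q * w ^ 2 := by positivity
  have hAw : A ≤ A * w ^ 2 := le_mul_of_one_le_right hA.le hw1
  have b1 : Real.exp (-V + A * (Real.exp (-(q / 2 * w ^ 2)) * Real.cos w - 1)) ≤
      Real.exp (-(A * q / 4)) * Real.exp (-V) := by
    rw [← Real.exp_add, Real.exp_le_exp]
    have h0 := exp_neg_le_quadratic (x := q / 2) (by positivity)
    have h' : Real.exp (-(q / 2 * w ^ 2)) ≤ Real.exp (-(q / 2)) :=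
      Real.exp_le_exp.2 (neg_le_neg (le_mul_of_one_le_right (by positivity) hw1))
    have hqq : q ^ 2 ≤ q := by nlinarith
    have h2 : Real.exp (-(q / 2 * w ^ 2)) * Real.cos w ≤ 1 - q / 4 :=
      (mul_le_of_le_one_right (Real.exp_pos _).le (Real.cos_le_one _)).trans (by linarith)
    have h3 : A * (Real.exp (-(q / 2 * w ^ 2)) * Real.cos w - 1) ≤ A * (-(q / 4)) := by
      gcongr
      linarith
    linarith
  have b2 : Real.exp (-V - A * ((1 + q) * w ^ 2 / 2)) ≤
      3200 / A * Real.exp (-(A * w ^ 2 / 10)) := by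
    have h1 : Real.exp (-V - A * ((1 + q) * w ^ 2 / 2)) ≤
        Real.exp (-(A / 4)) * Real.exp (-(A * w ^ 2 / 10)) := by
      rw [← Real.exp_add, Real.exp_le_exp]
      linarith
    refine h1.trans ?_
    gcongr
    rw [Real.exp_neg, inv_le_comm₀ (Real.exp_pos _) (by positivity), inv_div]
    have := Real.add_one_le_exp (A / 4)
    linarith
  refine (abs_sub _ _).trans ?_
  rw [abs_mul, abs_of_pos (Real.exp_pos _), abs_of_pos (Real.exp_pos (-V - _))]
  have b3 := mul_le_of_le_one_right (Real.exp_pos (-V + A * (Real.exp (-(q / 2 * w ^ 2)) *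
    Real.cos w - 1))).le (Real.abs_cos_le_one y)
  linarith

theorem abs_saddle_sub_gaussian_le {v d A a : ℝ} (hv : 0 < v) (hd : 0 < d) (hA : 0 < A)
    (ha : 0 < a) (hda : d ≤ a ^ 2) (u : ℝ) :
    |Real.exp (saddleRe v d A a u) * Real.cos (saddleIm d A a u) -
        Real.exp (-((v + A * (a ^ 2 + d)) / 2) * u ^ 2)| ≤
      3200 / A * Real.exp (-(A * a ^ 2 / 10) * u ^ 2) +
        Real.exp (-(A * d / (4 * a ^ 2))) * Real.exp (-(v / 2) * u ^ 2) := by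
  obtain ⟨q, hq⟩ : ∃ q, q = d / a ^ 2 := ⟨_, rfl⟩
  have hq0 : 0 ≤ q := by rw [hq]; positivity
  have hq1 : q ≤ 1 := by rw [hq]; exact (div_le_one (by positivity)).2 hda
  have hdq : d = q * a ^ 2 := by rw [hq]; field_simp
  have hV : 0 ≤ v / 2 * u ^ 2 := by positivity
  have ex : -(d / 2) * u ^ 2 = -(q / 2 * (a * u) ^ 2) := by rw [hdq]; ring
  have eV : -(v / 2) * u ^ 2 = -(v / 2 * u ^ 2) := by ring
  have eg : -((v + A * (a ^ 2 + d)) / 2) * u ^ 2 =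
      -(v / 2 * u ^ 2) - A * ((1 + q) * (a * u) ^ 2 / 2) := by
    rw [hdq]; ring
  have e10 : -(A * a ^ 2 / 10) * u ^ 2 = -(A * (a * u) ^ 2 / 10) := by ring
  have e4 : A * d / (4 * a ^ 2) = A * q / 4 := by rw [hq]; ring
  rw [saddleRe, saddleIm, eg, e10, e4, ex, eV]
  rcases le_or_gt |a * u| 1 with h | h
  · exact (abs_saddle_sub_gaussian_le_of_small hV hA hq0 hq1 h).trans
      (le_add_of_nonneg_right (by positivity))
  · exact abs_saddle_sub_gaussian_le_of_large _ hV hA hq0 hq1 h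

/-- The jump part of the exponent is nonpositive, so the diffusion alone provides a Gaussian
majorant. -/
theorem integrable_saddle {v d A a : ℝ} (hv : 0 < v) (hd : 0 < d) (hA : 0 < A) :
    Integrable fun u => Real.exp (saddleRe v d A a u) * Real.cos (saddleIm d A a u) := by
  refine (integrable_exp_neg_mul_sq (b := v / 2) (by positivity)).mono' ?_ (ae_of_all _ fun u => ?_)
  · refine Continuous.aestronglyMeasurable ?_
    unfold saddleRe saddleIm
    fun_prop
  · rw [Real.norm_eq_abs, abs_mul, abs_of_pos (Real.exp_pos _)]
    refine (mul_le_of_le_one_right (Real.exp_pos _).le (Real.abs_cos_le_one _)).trans ?_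
    gcongr
    rw [saddleRe]
    have h1 : Real.exp (-(d / 2) * u ^ 2) ≤ 1 := Real.exp_le_one_iff.2 (by
      rw [neg_mul, neg_nonpos]; positivity)
    have h2 : Real.exp (-(d / 2) * u ^ 2) * Real.cos (a * u) ≤ 1 :=
      (mul_le_of_le_one_right (Real.exp_pos _).le (Real.cos_le_one _)).trans h1
    nlinarith

/-- Quantitative Laplace approximation of the saddle point integral. -/
theorem abs_integral_saddle_sub_le {v d A a : ℝ} (hv : 0 < v) (hd : 0 < d) (hA : 0 < A)
    (ha : 0 < a) (hda : d ≤ a ^ 2) :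
    |(∫ u, Real.exp (saddleRe v d A a u) * Real.cos (saddleIm d A a u)) -
        √(2 * Real.pi / (v + A * (a ^ 2 + d)))| ≤
      3200 / A * √(10 * Real.pi / (A * a ^ 2)) +
        Real.exp (-(A * d / (4 * a ^ 2))) * √(2 * Real.pi / v) := by
  have g : ∀ K : ℝ, √(2 * Real.pi / K) = ∫ u : ℝ, Real.exp (-(K / 2) * u ^ 2) := by
    intro K
    rw [integral_gaussian]
    congr 1
    rw [div_div_eq_mul_div, mul_comm]
  have g' : √(10 * Real.pi / (A * a ^ 2)) = ∫ u : ℝ, Real.exp (-(A * a ^ 2 / 10) * u ^ 2) := by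
    rw [integral_gaussian]
    congr 1
    rw [div_div_eq_mul_div, mul_comm]
  rw [g, g, g', ← integral_sub (integrable_saddle hv hd hA)
    (integrable_exp_neg_mul_sq (by positivity)), ← integral_const_mul, ← integral_const_mul,
    ← integral_add ((integrable_exp_neg_mul_sq (by positivity)).const_mul _)
      ((integrable_exp_neg_mul_sq (by positivity)).const_mul _)]
  refine abs_integral_le_integral_abs.trans (integral_mono ?_ ?_ fun u =>
    abs_saddle_sub_gaussian_le hv hd hA ha hda u)
  · exact ((integrable_saddle hv hd hA).sub (integrable_exp_neg_mul_sq (by positivity))).abs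
  · exact ((integrable_exp_neg_mul_sq (by positivity)).const_mul _).add
      ((integrable_exp_neg_mul_sq (by positivity)).const_mul _)

theorem abs_saddle_relative_error_le {v d A a : ℝ} (hv : 0 < v) (hd : 0 < d) (hA : 0 < A)
    (ha : 0 < a) (hda : d ≤ a ^ 2) :
    |√((v + A * (a ^ 2 + d)) / (2 * Real.pi)) *
        (∫ u, Real.exp (saddleRe v d A a u) * Real.cos (saddleIm d A a u)) - 1| ≤
      3200 / A * √(5 * (v + A * (a ^ 2 + d)) / (A * a ^ 2)) +
        Real.exp (-(A * d / (4 * a ^ 2))) * √((v + A * (a ^ 2 + d)) / v) := by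
  have h := abs_integral_saddle_sub_le hv hd hA ha hda
  set K := v + A * (a ^ 2 + d) with hK
  have hK0 : 0 < K := by positivity
  set J := ∫ u, Real.exp (saddleRe v d A a u) * Real.cos (saddleIm d A a u)
  have e1 : √(K / (2 * Real.pi)) * √(2 * Real.pi / K) = 1 := by
    rw [← Real.sqrt_mul (by positivity), div_mul_div_cancel₀ (by positivity), div_self hK0.ne',
      Real.sqrt_one]
  have e2 : √(K / (2 * Real.pi)) * √(10 * Real.pi / (A * a ^ 2)) = √(5 * K / (A * a ^ 2)) := by
    rw [← Real.sqrt_mul (by positivity)]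
    congr 1
    field_simp
    ring
  have e3 : √(K / (2 * Real.pi)) * √(2 * Real.pi / v) = √(K / v) := by
    rw [← Real.sqrt_mul (by positivity)]
    congr 1
    field_simp
  calc |√(K / (2 * Real.pi)) * J - 1|
      = √(K / (2 * Real.pi)) * |J - √(2 * Real.pi / K)| := by
        rw [← abs_of_nonneg (Real.sqrt_nonneg (K / (2 * Real.pi))), ← abs_mul, mul_sub,
          abs_of_nonneg (Real.sqrt_nonneg (K / (2 * Real.pi))), e1]
    _ ≤ √(K / (2 * Real.pi)) * (3200 / A * √(10 * Real.pi / (A * a ^ 2)) +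
        Real.exp (-(A * d / (4 * a ^ 2))) * √(2 * Real.pi / v)) :=
      mul_le_mul_of_nonneg_left h (Real.sqrt_nonneg _)
    _ = _ := by rw [← e2, ← e3]; ring

/-! ### The cumulant generating function and the saddle point. -/

/-- The cumulant generating function of the Poisson–Gaussian mixture. -/
noncomputable def cumulant (β μ v d r s : ℝ) : ℝ :=
  β * s + v * s ^ 2 / 2 + r * (Real.exp (d * s ^ 2 / 2 + μ * s) - 1)

/-- The tilted jump intensity. -/
noncomputable def tiltedRate (μ d r s : ℝ) : ℝ := r * Real.exp (d * s ^ 2 / 2 + μ * s)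

/-- The first derivative of the cumulant generating function. -/
noncomputable def cumulantDeriv (β μ v d r s : ℝ) : ℝ :=
  β + v * s + tiltedRate μ d r s * (d * s + μ)

/-- The second derivative of the cumulant generating function. -/
noncomputable def cumulantDeriv₂ (μ v d r s : ℝ) : ℝ :=
  v + tiltedRate μ d r s * ((d * s + μ) ^ 2 + d)

section calculus

variable {β μ v d r : ℝ}

theorem tiltedRate_pos (hr : 0 < r) (s : ℝ) : 0 < tiltedRate μ d r s := by
  unfold tiltedRate; positivity

theorem hasDerivAt_tiltedRate (s : ℝ) :
    HasDerivAt (tiltedRate μ d r) (tiltedRate μ d r s * (d * s + μ)) s := by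
  have h : HasDerivAt (fun s : ℝ => d * s ^ 2 / 2 + μ * s) (d * s + μ) s :=
    (((((hasDerivAt_id s).pow 2).const_mul d).div_const 2).add
      ((hasDerivAt_id s).const_mul μ)).congr_deriv (by simp; ring)
  exact (h.exp.const_mul r).congr_deriv (by rw [tiltedRate]; ring)

theorem hasDerivAt_cumulant (s : ℝ) :
    HasDerivAt (cumulant β μ v d r) (cumulantDeriv β μ v d r s) s := by
  have e : cumulant β μ v d r = fun s => β * s + v * s ^ 2 / 2 + (tiltedRate μ d r s - r) := by
    ext t
    simp only [cumulant, tiltedRate]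
    ring
  rw [e]
  exact (((hasDerivAt_id s).const_mul β).add
    ((((hasDerivAt_id s).pow 2).const_mul v).div_const 2)).add
      ((hasDerivAt_tiltedRate (μ := μ) (d := d) (r := r) s).sub_const r) |>.congr_deriv (by
        simp [cumulantDeriv]; ring)

theorem hasDerivAt_cumulantDeriv (s : ℝ) :
    HasDerivAt (cumulantDeriv β μ v d r) (cumulantDeriv₂ μ v d r s) s :=
  (((hasDerivAt_id s).const_mul v).const_add β).add
    ((hasDerivAt_tiltedRate (μ := μ) (d := d) (r := r) s).mul
      (((hasDerivAt_id s).const_mul d).add_const μ)) |>.congr_deriv (by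
        simp [cumulantDeriv₂]; ring)

theorem cumulantDeriv₂_pos (hv : 0 < v) (hd : 0 < d) (hr : 0 < r) (s : ℝ) :
    0 < cumulantDeriv₂ μ v d r s := by
  have := tiltedRate_pos (μ := μ) (d := d) hr s
  unfold cumulantDeriv₂
  positivity

theorem cumulantDeriv_strictMono (hv : 0 < v) (hd : 0 < d) (hr : 0 < r) :
    StrictMono (cumulantDeriv β μ v d r) :=
  strictMono_of_deriv_pos fun s => by
    rw [(hasDerivAt_cumulantDeriv s).deriv]
    exact cumulantDeriv₂_pos hv hd hr s

theorem cumulantDeriv_continuous : Continuous (cumulantDeriv β μ v d r) := by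
  unfold cumulantDeriv tiltedRate
  fun_prop

/-- This is the cumulant derivative with drift and diffusion removed. Its monotonicity lets the
linear term `v * s` alone force the limits at `±∞`. -/
theorem monotone_tiltedRate_mul (hd : 0 < d) (hr : 0 < r) :
    Monotone fun s => tiltedRate μ d r s * (d * s + μ) := by
  have h : ∀ s, HasDerivAt (fun s => tiltedRate μ d r s * (d * s + μ))
      (cumulantDeriv₂ μ 0 d r s) s := by
    intro s
    have h0 := hasDerivAt_cumulantDeriv (β := 0) (μ := μ) (v := 0) (d := d) (r := r) s
    have e : cumulantDeriv 0 μ 0 d r = fun s => tiltedRate μ d r s * (d * s + μ) := by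
      ext t
      simp [cumulantDeriv]
    rwa [e] at h0
  refine monotone_of_deriv_nonneg (fun s => (h s).differentiableAt) fun s => ?_
  rw [(h s).deriv, cumulantDeriv₂]
  have := tiltedRate_pos (μ := μ) (d := d) hr s
  positivity

theorem tendsto_cumulantDeriv_atTop (hv : 0 < v) (hd : 0 < d) (hr : 0 < r) :
    Tendsto (cumulantDeriv β μ v d r) atTop atTop := by
  have h : Tendsto (fun s : ℝ => β + v * s + tiltedRate μ d r 0 * (d * 0 + μ)) atTop atTop :=
    tendsto_atTop_add_const_right _ _
      (tendsto_atTop_add_const_left _ _ (tendsto_id.const_mul_atTop hv))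
  refine tendsto_atTop_mono' _ ?_ h
  filter_upwards [eventually_ge_atTop 0] with s hs
  have := monotone_tiltedRate_mul (μ := μ) hd hr hs
  simp only [cumulantDeriv]
  linarith

theorem tendsto_cumulantDeriv_atBot (hv : 0 < v) (hd : 0 < d) (hr : 0 < r) :
    Tendsto (cumulantDeriv β μ v d r) atBot atBot := by
  have h : Tendsto (fun s : ℝ => β + v * s + tiltedRate μ d r 0 * (d * 0 + μ)) atBot atBot :=
    tendsto_atBot_add_const_right _ _
      (tendsto_atBot_add_const_left _ _ (tendsto_id.const_mul_atBot hv))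
  refine tendsto_atBot_mono' _ ?_ h
  filter_upwards [eventually_le_atBot 0] with s hs
  have := monotone_tiltedRate_mul (μ := μ) hd hr hs
  simp only [cumulantDeriv]
  linarith

/-- The saddle point map: the inverse of the derivative of the cumulant generating function. -/
theorem exists_saddlePoint (β μ : ℝ) (hv : 0 < v) (hd : 0 < d) (hr : 0 < r) :
    ∃ shat : ℝ → ℝ, (∀ k s, cumulantDeriv β μ v d r s = k ↔ s = shat k) ∧
      Tendsto shat atTop atTop := by
  have hmono := cumulantDeriv_strictMono (β := β) (μ := μ) hv hd hr
  have hsurj : Function.Surjective (cumulantDeriv β μ v d r) :=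
    cumulantDeriv_continuous.surjective (tendsto_cumulantDeriv_atTop hv hd hr)
      (tendsto_cumulantDeriv_atBot hv hd hr)
  choose shat hshat using hsurj
  refine ⟨shat, fun k s => ⟨fun h => hmono.injective (h.trans (hshat k).symm), fun h => ?_⟩, ?_⟩
  · rw [h, hshat]
  · refine tendsto_atTop.2 fun M => ?_
    filter_upwards [eventually_ge_atTop (cumulantDeriv β μ v d r M)] with k hk
    rw [← hshat k] at hk
    exact hmono.le_iff_le.1 hk

end calculus

/-! ### Growth of the tilted intensity and size of the error. -/

section growth

variable {μ v d r : ℝ}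

/-- Completing the square makes `A` a constant times `exp(a²/(2d))`, the source of the `√(log k)`
scale. -/
theorem tiltedRate_eq (hd : 0 < d) (s : ℝ) :
    tiltedRate μ d r s =
      r * Real.exp (-(μ ^ 2 / (2 * d))) * Real.exp ((d * s + μ) ^ 2 / (2 * d)) := by
  rw [tiltedRate, mul_assoc, ← Real.exp_add]
  congr 2
  field_simp
  ring

theorem eventually_saddle_regime (β μ : ℝ) (hv : 0 < v) (hd : 0 < d) (hr : 0 < r) :
    ∀ᶠ s in atTop, 1 ≤ d * s + μ ∧ d ≤ (d * s + μ) ^ 2 ∧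
      (d * s + μ) ^ 4 ≤ tiltedRate μ d r s ∧ 0 ≤ s ∧ s ≤ 2 / d * (d * s + μ) ∧
      0 ≤ β + v * s := by
  have ha : Tendsto (fun s : ℝ => d * s + μ) atTop atTop :=
    tendsto_atTop_add_const_right _ _ (tendsto_id.const_mul_atTop hd)
  have hb : Tendsto (fun s : ℝ => β + v * s) atTop atTop :=
    tendsto_atTop_add_const_left _ _ (tendsto_id.const_mul_atTop hv)
  -- The cubic term of the exponential series gives `A ≥ c a⁶`; then `a ≥ 1/c` and `a ≥ 1` give `c
  -- a² ≥ 1`.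
  set c := r * Real.exp (-(μ ^ 2 / (2 * d))) / (6 * (2 * d) ^ 3) with hc
  have hc0 : 0 < c := by positivity
  filter_upwards [ha.eventually_ge_atTop 1, ha.eventually_ge_atTop d, ha.eventually_ge_atTop (1 / c),
    eventually_ge_atTop 0, eventually_ge_atTop (-(2 * μ / d)), hb.eventually_ge_atTop 0]
    with s h1 h2 h3 h4 h5 h6
  set a := d * s + μ with hadef
  refine ⟨h1, by nlinarith, ?_, h4, ?_, h6⟩
  · rw [tiltedRate_eq hd]
    have h := Real.pow_div_factorial_le_exp (a ^ 2 / (2 * d)) (by positivity) 3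
    have hca : 1 ≤ c * a ^ 2 := by
      rw [div_le_iff₀ hc0] at h3
      nlinarith
    calc a ^ 4 = 1 * a ^ 4 := (one_mul _).symm
      _ ≤ (c * a ^ 2) * a ^ 4 := by gcongr
      _ = r * Real.exp (-(μ ^ 2 / (2 * d))) * ((a ^ 2 / (2 * d)) ^ 3 / (Nat.factorial 3 : ℝ)) := by
        rw [hc]
        norm_num [Nat.factorial]
        field_simp
      _ ≤ _ := by gcongr
  · have h7 : -(2 * μ) ≤ d * s := by
      rw [← neg_div, div_le_iff₀ hd] at h5
      linarith
    rw [div_mul_eq_mul_div, le_div_iff₀ hd]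
    linarith

theorem saddle_bound_le {a A : ℝ} (hv : 0 < v) (hd : 0 < d) (ha : 1 ≤ a) (hda : d ≤ a ^ 2)
    (haA : a ^ 4 ≤ A) :
    3200 / A * √(5 * (v + A * (a ^ 2 + d)) / (A * a ^ 2)) +
        Real.exp (-(A * d / (4 * a ^ 2))) * √((v + A * (a ^ 2 + d)) / v) ≤
      (3200 * √(5 * (v + 2)) + 24 * (4 / d) ^ 4 * √((v + 2) / v)) / A := by
  have ha2 : 1 ≤ a ^ 2 := one_le_pow₀ ha
  have hA1 : 1 ≤ A := (one_le_pow₀ ha).trans haA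
  have hA0 : 0 < A := by linarith
  have hK : v + A * (a ^ 2 + d) ≤ (v + 2) * (A * a ^ 2) := by
    have h1 : 1 ≤ A * a ^ 2 := by nlinarith
    nlinarith
  have b1 : √(5 * (v + A * (a ^ 2 + d)) / (A * a ^ 2)) ≤ √(5 * (v + 2)) := by
    apply Real.sqrt_le_sqrt
    rw [div_le_iff₀ (by positivity)]
    linarith
  -- `a⁴ ≤ A` gives `a² ≤ x`, hence `A ≤ x²`. The exponential is `O(x⁻⁴)` and the square root
  -- `O(x²)`, so their product is `O(1/A)`.
  set x := A / a ^ 2 with hx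
  have hxA : A = x * a ^ 2 := by rw [hx]; field_simp
  have hx0 : 0 < x := by positivity
  have hax : a ^ 2 ≤ x := by
    rw [hx, le_div_iff₀ (by positivity)]
    linarith [pow_mul a 2 2, sq (a ^ 2)]
  have b2 : √((v + A * (a ^ 2 + d)) / v) ≤ √((v + 2) / v) * x ^ 2 := by
    rw [← Real.sqrt_sq (by positivity : 0 ≤ x ^ 2), ← Real.sqrt_mul (by positivity)]
    apply Real.sqrt_le_sqrt
    rw [div_mul_eq_mul_div]
    gcongr
    refine hK.trans ?_
    gcongr
    rw [hxA]
    have hx1 : 1 ≤ x := ha2.trans hax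
    calc x * a ^ 2 * a ^ 2 ≤ x * x * x := by gcongr
      _ ≤ x * x * x * x := le_mul_of_one_le_right (by positivity) hx1
      _ = (x ^ 2) ^ 2 := by ring
  have b3 : Real.exp (-(A * d / (4 * a ^ 2))) ≤ 24 * (4 / d) ^ 4 / x ^ 4 := by
    have e : A * d / (4 * a ^ 2) = x * d / 4 := by rw [hx]; field_simp
    have h := Real.pow_div_factorial_le_exp (x * d / 4) (by positivity) 4
    rw [e, Real.exp_neg, inv_le_comm₀ (Real.exp_pos _) (by positivity)]
    refine le_trans (le_of_eq ?_) h
    norm_num [Nat.factorial]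
    field_simp
  have b4 : A ≤ x ^ 2 := by
    calc A = x * a ^ 2 := hxA
      _ ≤ x * x := by gcongr
      _ = x ^ 2 := by ring
  calc _ ≤ 3200 / A * √(5 * (v + 2)) + 24 * (4 / d) ^ 4 / x ^ 4 * (√((v + 2) / v) * x ^ 2) := by
        gcongr
    _ = 3200 / A * √(5 * (v + 2)) + 24 * (4 / d) ^ 4 * √((v + 2) / v) / x ^ 2 := by
        congr 1
        field_simp
    _ ≤ 3200 / A * √(5 * (v + 2)) + 24 * (4 / d) ^ 4 * √((v + 2) / v) / A := by gcongr
    _ = _ := by ring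

end growth

/-! ### Asymptotics of the density, parametrised by the saddle point. -/

section pdf

variable (β μ : ℝ) {v d r : ℝ≥0}

/-- The relative error of the saddle point approximation. -/
noncomputable def saddleError (μ : ℝ) (v d r : ℝ≥0) (s : ℝ) : ℝ :=
  √(cumulantDeriv₂ μ v d r s / (2 * Real.pi)) *
    (∫ u, Real.exp (saddleRe v d (tiltedRate μ d r s) (d * s + μ) u) *
      Real.cos (saddleIm d (tiltedRate μ d r s) (d * s + μ) u)) - 1

theorem poissonGaussianPDF_eq_saddleError (hv : 0 < v) (hd : 0 < d) (hr : 0 < r) (s : ℝ) :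
    poissonGaussianPDF β μ v d r (cumulantDeriv β μ v d r s) =
      Real.exp (cumulant β μ v d r s - s * cumulantDeriv β μ v d r s) /
        √(2 * Real.pi * cumulantDeriv₂ μ v d r s) * (1 + saddleError μ v d r s) := by
  have hK := cumulantDeriv₂_pos (μ := μ) (NNReal.coe_pos.2 hv) (NNReal.coe_pos.2 hd)
    (NNReal.coe_pos.2 hr) s
  have h := poissonGaussianPDF_eq_saddle β μ d r hv
    (k := cumulantDeriv β μ v d r s) (s := s) rfl
  rw [saddleError, add_sub_cancel]
  change _ = Real.exp (cumulant β μ v d r s - s * cumulantDeriv β μ v d r s) *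
    (∫ u, Real.exp (saddleRe v d (tiltedRate μ d r s) (d * s + μ) u) *
      Real.cos (saddleIm d (tiltedRate μ d r s) (d * s + μ) u)) at h
  generalize (∫ u, Real.exp (saddleRe v d (tiltedRate μ d r s) (d * s + μ) u) *
      Real.cos (saddleIm d (tiltedRate μ d r s) (d * s + μ) u)) = J at h ⊢
  generalize cumulantDeriv₂ μ v d r s = K at hK ⊢
  have e : √(K / (2 * Real.pi)) = √(2 * Real.pi * K) / (2 * Real.pi) := by
    rw [eq_div_iff (by positivity), ← Real.sqrt_sq (by positivity : 0 ≤ 2 * Real.pi),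
      ← Real.sqrt_mul (by positivity)]
    congr 1
    rw [Real.sqrt_sq (by positivity)]
    field_simp
  have hs : 0 < √(2 * Real.pi * K) := Real.sqrt_pos.2 (by positivity)
  have h' : poissonGaussianPDF β μ v d r (cumulantDeriv β μ v d r s) =
      Real.exp (cumulant β μ v d r s - s * cumulantDeriv β μ v d r s) * J / (2 * Real.pi) := by
    rw [← h]; field_simp
  rw [h', e]
  field_simp

theorem exists_abs_saddleError_le (hv : 0 < v) (hd : 0 < d) (hr : 0 < r) :
    ∃ C, 0 ≤ C ∧ ∀ᶠ s in atTop, |saddleError μ v d r s| ≤ C / tiltedRate μ d r s := by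
  have hv' : (0 : ℝ) < v := hv
  have hd' : (0 : ℝ) < d := hd
  have hr' : (0 : ℝ) < r := hr
  refine ⟨3200 * √(5 * (v + 2)) + 24 * (4 / d) ^ 4 * √((v + 2) / v), by positivity, ?_⟩
  filter_upwards [eventually_saddle_regime 0 μ hv' hd' hr'] with s ⟨h1, h2, h3, _⟩
  exact (abs_saddle_relative_error_le hv' hd' (tiltedRate_pos hr' s) (by linarith) h2).trans
    (saddle_bound_le hv' hd' h1 h2 h3)

end pdf

section growth

variable {v d r : ℝ}

/-- The lower bound turns errors `O(A)` into `O(k)`; the bound by `A a` controls `log k`; the cruder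
bound by `A²`, from `a ≤ A`, turns `1/A` into `O(k^(-1/2))`. -/
theorem exists_cumulantDeriv_bounds (β μ : ℝ) (hv : 0 < v) (hd : 0 < d) (hr : 0 < r) :
    ∃ C, 0 < C ∧ ∀ᶠ s in atTop, tiltedRate μ d r s ≤ cumulantDeriv β μ v d r s ∧
      cumulantDeriv β μ v d r s ≤ C * (tiltedRate μ d r s * (d * s + μ)) ∧
      cumulantDeriv β μ v d r s ≤ C * tiltedRate μ d r s ^ 2 := by
  refine ⟨|β| + v * (2 / d) + 1, by positivity, ?_⟩
  filter_upwards [eventually_saddle_regime β μ hv hd hr] with s ⟨h1, _, h3, _, h5, h6⟩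
  simp only [cumulantDeriv]
  generalize tiltedRate μ d r s = A at h3 ⊢
  generalize d * s + μ = a at h1 h3 h5 ⊢
  have hA1 : 1 ≤ A := (one_le_pow₀ h1).trans h3
  have haA : a ≤ A := (le_self_pow₀ h1 (by norm_num)).trans h3
  have hAa : a ≤ A * a := le_mul_of_one_le_left (by linarith) hA1
  have hup : β + v * s + A * a ≤ (|β| + v * (2 / d) + 1) * (A * a) := by
    have h7 : |β| * 1 ≤ |β| * (A * a) := by gcongr; linarith
    have h8 : v * s ≤ v * (2 / d) * (A * a) := by
      calc v * s ≤ v * (2 / d * a) := by gcongr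
        _ = v * (2 / d) * a := by ring
        _ ≤ _ := by gcongr
    linarith [le_abs_self β]
  refine ⟨by nlinarith, hup, hup.trans ?_⟩
  rw [sq]
  gcongr

/-- The saddle point is later multiplied by `k`, so it must be known up to `O(1)`. With `R = √(2d
log κ)`, one has `R² - a² = O(a)`, and dividing by `R + a ≥ a` gives `R - a = O(1)`. -/
theorem exists_abs_sqrt_log_sub_le (β μ : ℝ) (hv : 0 < v) (hd : 0 < d) (hr : 0 < r) :
    ∃ C, ∀ᶠ s in atTop,
      |√(2 * d * Real.log (cumulantDeriv β μ v d r s)) / d - s| ≤ C := by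
  obtain ⟨C, hC, hb⟩ := exists_cumulantDeriv_bounds β μ hv hd hr
  set L := 2 * d * |Real.log r| + μ ^ 2 with hL
  have hL0 : 0 ≤ L := by positivity
  refine ⟨(L + 2 * d * |Real.log C| + 2 * d + |μ|) / d, ?_⟩
  filter_upwards [hb, eventually_saddle_regime β μ hv hd hr] with s ⟨b1, b2, _⟩ ⟨h1, _, h3, _⟩
  have hA0 : 0 < tiltedRate μ d r s := tiltedRate_pos hr s
  have hlogA : 2 * d * Real.log (tiltedRate μ d r s) =
      2 * d * Real.log r - μ ^ 2 + (d * s + μ) ^ 2 := by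
    rw [tiltedRate, Real.log_mul hr.ne' (Real.exp_pos _).ne', Real.log_exp]
    ring
  have hsa : s = ((d * s + μ) - μ) / d := by field_simp; ring
  generalize tiltedRate μ d r s = A at *
  generalize cumulantDeriv β μ v d r s = κ at *
  generalize d * s + μ = a at *
  have hA1 : 1 ≤ A := (one_le_pow₀ h1).trans h3
  have ha0 : 0 < a := by linarith
  have hκ0 : 0 < κ := by linarith
  have l1 : Real.log A ≤ Real.log κ := Real.log_le_log hA0 b1
  have l2 : Real.log κ ≤ Real.log C + Real.log A + Real.log a := by
    have := Real.log_le_log hκ0 b2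
    rw [Real.log_mul hC.ne' (by positivity), Real.log_mul hA0.ne' ha0.ne'] at this
    linarith
  have l3 : Real.log a ≤ a := (Real.log_le_sub_one_of_pos ha0).trans (by linarith)
  have l4 : 0 ≤ Real.log κ := Real.log_nonneg (hA1.trans b1)
  set R := √(2 * d * Real.log κ) with hR
  have hR0 : 0 ≤ R := Real.sqrt_nonneg _
  have hRsq : R ^ 2 = 2 * d * Real.log κ := Real.sq_sqrt (by positivity)
  have m1 := mul_le_mul_of_nonneg_left l1 (by positivity : 0 ≤ 2 * d)
  have m2 := mul_le_mul_of_nonneg_left l2 (by positivity : 0 ≤ 2 * d)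
  have m3 := mul_le_mul_of_nonneg_left l3 (by positivity : 0 ≤ 2 * d)
  have m4 := mul_le_mul_of_nonneg_left (le_abs_self (Real.log C)) (by positivity : 0 ≤ 2 * d)
  have m5 := mul_le_mul_of_nonneg_left (le_abs_self (Real.log r)) (by positivity : 0 ≤ 2 * d)
  have m6 := mul_le_mul_of_nonneg_left (neg_abs_le (Real.log r)) (by positivity : 0 ≤ 2 * d)
  have hM0 : 0 ≤ 2 * d * |Real.log C| := by positivity
  have hsq : |R ^ 2 - a ^ 2| ≤ (L + 2 * d * |Real.log C| + 2 * d) * a := by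
    have hLa : L ≤ L * a := le_mul_of_one_le_right hL0 h1
    have hCa : 2 * d * |Real.log C| ≤ 2 * d * |Real.log C| * a := le_mul_of_one_le_right hM0 h1
    have hda : 0 ≤ 2 * d * a := by positivity
    rw [hRsq, abs_le]
    constructor <;> nlinarith [sq_nonneg μ]
  have hRa : |R - a| ≤ L + 2 * d * |Real.log C| + 2 * d := by
    have e : R ^ 2 - a ^ 2 = (R - a) * (R + a) := by ring
    rw [e, abs_mul, abs_of_pos (by linarith : 0 < R + a)] at hsq
    have : |R - a| * a ≤ (L + 2 * d * |Real.log C| + 2 * d) * a :=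
      (mul_le_mul_of_nonneg_left (by linarith) (abs_nonneg _)).trans hsq
    exact le_of_mul_le_mul_right this ha0
  have e : R / d - s = ((R - a) + μ) / d := by rw [hsa]; ring
  rw [e, abs_div, abs_of_pos hd]
  gcongr
  exact (abs_add_le _ _).trans (by linarith)

theorem exists_abs_cumulant_le (β μ : ℝ) (hv : 0 < v) (hd : 0 < d) (hr : 0 < r) :
    ∃ C, ∀ᶠ s in atTop, |cumulant β μ v d r s| ≤ C * tiltedRate μ d r s := by
  refine ⟨|β| * (2 / d) + v * (2 / d) ^ 2 / 2 + 1 + r, ?_⟩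
  filter_upwards [eventually_saddle_regime β μ hv hd hr] with s ⟨h1, _, h3, h4, h5, _⟩
  have e : cumulant β μ v d r s = β * s + v * s ^ 2 / 2 + tiltedRate μ d r s - r := by
    rw [cumulant, tiltedRate]; ring
  rw [e]
  generalize tiltedRate μ d r s = A at *
  generalize d * s + μ = a at *
  have hA1 : 1 ≤ A := (one_le_pow₀ h1).trans h3
  have haA : a ≤ A := (le_self_pow₀ h1 (by norm_num)).trans h3
  have ha2A : a ^ 2 ≤ A := (pow_le_pow_right₀ h1 (by norm_num)).trans h3
  have b1 : |β * s| ≤ |β| * (2 / d) * A := by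
    rw [abs_mul, abs_of_nonneg h4, mul_assoc]
    gcongr
    exact h5.trans (by gcongr)
  have b2 : v * s ^ 2 / 2 ≤ v * (2 / d) ^ 2 / 2 * A := by
    calc v * s ^ 2 / 2 ≤ v * (2 / d * a) ^ 2 / 2 := by gcongr
      _ = v * (2 / d) ^ 2 / 2 * a ^ 2 := by ring
      _ ≤ _ := by gcongr
  have b3 : 0 ≤ v * s ^ 2 / 2 := by positivity
  have b4 : r ≤ r * A := le_mul_of_one_le_right hr.le hA1
  have b5 := abs_le.1 b1
  rw [abs_le]
  constructor <;> linarith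

theorem exists_abs_log_cumulantDeriv₂_le (μ : ℝ) (hv : 0 < v) (hd : 0 < d) (hr : 0 < r) :
    ∃ C, ∀ᶠ s in atTop, |Real.log (2 * Real.pi * cumulantDeriv₂ μ v d r s)| ≤
      C * tiltedRate μ d r s := by
  refine ⟨|Real.log (2 * Real.pi * (v + 2))| + 2, ?_⟩
  filter_upwards [eventually_saddle_regime 0 μ hv hd hr] with s ⟨h1, h2, h3, _⟩
  rw [cumulantDeriv₂]
  generalize tiltedRate μ d r s = A at *
  generalize d * s + μ = a at *
  have hA1 : 1 ≤ A := (one_le_pow₀ h1).trans h3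
  have hA0 : 0 < A := by linarith
  have ha2A : a ^ 2 ≤ A := (pow_le_pow_right₀ h1 (by norm_num)).trans h3
  have ha2 : 1 ≤ a ^ 2 := one_le_pow₀ h1
  have hlow : 1 ≤ v + A * (a ^ 2 + d) := by nlinarith [mul_pos hA0 hd]
  have hup : v + A * (a ^ 2 + d) ≤ (v + 2) * A ^ 2 := by
    have : v * 1 ≤ v * A ^ 2 := by gcongr; exact one_le_pow₀ hA1
    nlinarith
  have hpi : 1 ≤ 2 * Real.pi := by linarith [Real.pi_gt_three]
  have hl0 : 0 ≤ Real.log (2 * Real.pi * (v + A * (a ^ 2 + d))) :=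
    Real.log_nonneg (one_le_mul_of_one_le_of_one_le hpi hlow)
  rw [abs_of_nonneg hl0]
  have hl1 : Real.log (2 * Real.pi * (v + A * (a ^ 2 + d))) ≤
      Real.log (2 * Real.pi * (v + 2) * A ^ 2) := by
    apply Real.log_le_log (by positivity)
    rw [mul_assoc (2 * Real.pi) (v + 2)]
    exact mul_le_mul_of_nonneg_left hup (by positivity)
  rw [Real.log_mul (x := 2 * Real.pi * (v + 2)) (by positivity) (by positivity),
    Real.log_pow] at hl1
  have hl2 := Real.log_le_sub_one_of_pos hA0
  have hl3 : |Real.log (2 * Real.pi * (v + 2))| ≤ |Real.log (2 * Real.pi * (v + 2))| * A :=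
    le_mul_of_one_le_right (abs_nonneg _) hA1
  push_cast at hl1
  linarith [le_abs_self (Real.log (2 * Real.pi * (v + 2)))]

end growth

section pdf

variable (β μ : ℝ) {v d r : ℝ≥0}

theorem saddleError_isBigO (hv : 0 < v) (hd : 0 < d) (hr : 0 < r) :
    saddleError μ v d r =O[atTop]
      fun s => cumulantDeriv β μ v d r s ^ (-(1 / 2) : ℝ) := by
  obtain ⟨C, hC, hb⟩ := exists_abs_saddleError_le μ hv hd hr
  obtain ⟨D, hD, hb'⟩ := exists_cumulantDeriv_bounds β μ (NNReal.coe_pos.2 hv)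
    (NNReal.coe_pos.2 hd) (NNReal.coe_pos.2 hr)
  refine IsBigO.of_bound (C * √D) ?_
  filter_upwards [hb, hb'] with s h1 ⟨h2, _, h3⟩
  have hA0 : 0 < tiltedRate μ d r s := tiltedRate_pos (NNReal.coe_pos.2 hr) s
  generalize tiltedRate μ d r s = A at *
  generalize cumulantDeriv β μ v d r s = κ at *
  have hκ : 0 < κ := by linarith
  rw [Real.norm_eq_abs, Real.norm_of_nonneg (by positivity), Real.rpow_neg hκ.le,
    ← Real.sqrt_eq_rpow]
  refine h1.trans ?_
  have h4 : √κ ≤ √D * A := by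
    rw [← Real.sqrt_sq hA0.le, ← Real.sqrt_mul hD.le]
    exact Real.sqrt_le_sqrt h3
  have hs : 0 < √κ := Real.sqrt_pos.2 hκ
  rw [mul_assoc, div_eq_mul_inv]
  gcongr
  rw [← div_eq_mul_inv, le_div_iff₀ hs, inv_mul_le_iff₀ hA0]
  linarith

theorem eventually_abs_saddleError_le_half (hv : 0 < v) (hd : 0 < d) (hr : 0 < r) :
    ∀ᶠ s in atTop, |saddleError μ v d r s| ≤ 1 / 2 := by
  have h := saddleError_isBigO 0 μ hv hd hr
  have h2 := (tendsto_rpow_neg_atTop (by norm_num : (0 : ℝ) < 1 / 2)).comp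
    (tendsto_cumulantDeriv_atTop (β := 0) (μ := μ) (NNReal.coe_pos.2 hv)
      (NNReal.coe_pos.2 hd) (NNReal.coe_pos.2 hr))
  have h3 := (h.trans_tendsto h2).abs
  rw [abs_zero] at h3
  exact h3.eventually_le_const (by norm_num)

theorem exists_abs_log_poissonGaussianPDF_le (hv : 0 < v) (hd : 0 < d) (hr : 0 < r) :
    ∃ C, ∀ᶠ s in atTop,
      |Real.log (poissonGaussianPDF β μ v d r (cumulantDeriv β μ v d r s)) +
        √(2 * d * Real.log (cumulantDeriv β μ v d r s)) / d * cumulantDeriv β μ v d r s| ≤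
      C * cumulantDeriv β μ v d r s := by
  have hv' : (0 : ℝ) < v := hv
  have hd' : (0 : ℝ) < d := hd
  have hr' : (0 : ℝ) < r := hr
  obtain ⟨C₁, b1⟩ := exists_abs_sqrt_log_sub_le β μ hv' hd' hr'
  obtain ⟨C₂, b2⟩ := exists_abs_cumulant_le β μ hv' hd' hr'
  obtain ⟨C₃, b3⟩ := exists_abs_log_cumulantDeriv₂_le μ hv' hd' hr'
  obtain ⟨D, -, b4⟩ := exists_cumulantDeriv_bounds β μ hv' hd' hr'
  refine ⟨C₁ + |C₂| + |C₃| / 2 + 1, ?_⟩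
  filter_upwards [b1, b2, b3, b4, eventually_abs_saddleError_le_half μ hv hd hr,
    eventually_saddle_regime β μ hv' hd' hr'] with s h1 h2 h3 ⟨h4, _⟩ h5 ⟨h6, _, h7, _⟩
  rw [poissonGaussianPDF_eq_saddleError β μ hv hd hr]
  have hK := cumulantDeriv₂_pos (μ := μ) hv' hd' hr' s
  have hA1 : 1 ≤ tiltedRate μ d r s := (one_le_pow₀ h6).trans h7
  generalize saddleError μ v d r s = ε at *
  generalize cumulant β μ v d r s = G at *
  generalize cumulantDeriv₂ μ v d r s = K at *
  generalize tiltedRate μ d r s = A at *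
  generalize cumulantDeriv β μ v d r s = κ at *
  have h5' := abs_le.1 h5
  have hε : 0 < 1 + ε := by linarith
  have hsq : 0 < √(2 * Real.pi * K) := Real.sqrt_pos.2 (by positivity)
  have hlε : |Real.log (1 + ε)| ≤ 1 := by
    have u1 := Real.log_le_sub_one_of_pos hε
    have u2 := Real.one_sub_inv_le_log_of_pos hε
    have u3 : (1 + ε)⁻¹ ≤ 2 := by
      rw [inv_le_comm₀ hε (by norm_num)]; linarith
    rw [abs_le]; constructor <;> linarith
  rw [Real.log_mul (by positivity) hε.ne', Real.log_div (Real.exp_pos _).ne' hsq.ne', Real.log_exp,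
    Real.log_sqrt (by positivity)]
  have hκ0 : 0 ≤ κ := by linarith
  set Q := √(2 * d * Real.log κ) / d
  -- Each of the four terms is `O(κ)`: the saddle point is known up to `O(1)`, the next two are
  -- `O(A)` with `A ≤ κ`, and `|ε| ≤ 1/2` bounds the last.
  have e : G - s * κ - Real.log (2 * Real.pi * K) / 2 + Real.log (1 + ε) + Q * κ =
      (Q - s) * κ + G - Real.log (2 * Real.pi * K) / 2 + Real.log (1 + ε) := by ring
  have k1 : |(Q - s) * κ| ≤ C₁ * κ := by
    rw [abs_mul, abs_of_nonneg hκ0]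
    gcongr
  have k2 : |G| ≤ |C₂| * κ := h2.trans (by gcongr; exact le_abs_self _)
  have k3 : |Real.log (2 * Real.pi * K)| ≤ |C₃| * κ := h3.trans (by gcongr; exact le_abs_self _)
  rw [abs_le] at k1 k2 k3 hlε
  rw [e, abs_le]
  constructor <;> linarith

end pdf

/-! ### Transfer to random variables and conclusion. -/

section law

variable {Ω : Type*} [MeasurableSpace Ω] {P : Measure Ω} {X : Ω → ℝ}

/-- In the change of variables along `exp`, which maps `ℝ` injectively onto `(0, ∞)`, the Jacobian
`exp x` cancels the division by `x`. -/
theorem IsContinuousDensityOn.exp {f : ℝ → ℝ} (h : IsContinuousDensityOn f Set.univ X P) :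
    IsContinuousDensityOn (fun x => if 0 < x then f (Real.log x) / x else 0) (Set.Ioi 0)
      (fun ω => Real.exp (X ω)) P where
  nonneg x := by
    split_ifs with hx
    · exact div_nonneg (h.nonneg _) hx.le
    · exact le_rfl
  continuousOn := by
    have hf : Continuous f := continuousOn_univ.1 h.continuousOn
    have h1 : ContinuousOn (fun x => f (Real.log x) / x) (Set.Ioi 0) :=
      (hf.comp_continuousOn (Real.continuousOn_log.mono fun x hx => (Set.mem_Ioi.1 hx).ne')).div
        continuousOn_id fun x hx => (Set.mem_Ioi.1 hx).ne'
    exact h1.congr fun x hx => if_pos hx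
  eq_zero x hx := if_neg hx
  hasLaw := by
    have hX := h.hasLaw
    refine ⟨Real.measurable_exp.comp_aemeasurable hX.aemeasurable, ?_⟩
    have e : (fun ω => Real.exp (X ω)) = Real.exp ∘ X := rfl
    rw [e, ← AEMeasurable.map_map_of_aemeasurable Real.measurable_exp.aemeasurable hX.aemeasurable,
      hX.map_eq]
    ext B hB
    have hB' : MeasurableSet (Real.exp ⁻¹' B) := Real.measurable_exp hB
    rw [Measure.map_apply Real.measurable_exp hB, withDensity_apply _ hB', withDensity_apply _ hB]
    have e1 : (fun x => ENNReal.ofReal (if 0 < x then f (Real.log x) / x else 0)) =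
        (Set.Ioi (0 : ℝ)).indicator fun x => ENNReal.ofReal (f (Real.log x) / x) := by
      ext x
      by_cases hx : 0 < x
      · simp [hx]
      · simp [hx]
    have e2 : Set.Ioi 0 ∩ B = Real.exp '' (Real.exp ⁻¹' B) := by
      rw [Set.image_preimage_eq_inter_range, Real.range_exp, Set.inter_comm]
    rw [e1, setLIntegral_indicator measurableSet_Ioi, e2,
      lintegral_image_eq_lintegral_abs_deriv_mul hB'
        (fun x _ => (Real.hasDerivAt_exp x).hasDerivWithinAt) Real.exp_injective.injOn]
    refine lintegral_congr fun x => ?_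
    rw [abs_of_pos (Real.exp_pos _), ← ENNReal.ofReal_mul (Real.exp_pos _).le, Real.log_exp]
    congr 1
    field_simp

variable {β μ : ℝ} {v d r : ℝ≥0}

theorem ProbabilityTheory.HasLaw.isContinuousDensityOn_poissonGaussian
    (hX : HasLaw X (poissonGaussian β μ v d r) P) (hv : 0 < v) :
    IsContinuousDensityOn (poissonGaussianPDF β μ v d r) Set.univ X P where
  nonneg x := (poissonGaussianPDF_pos β μ d r hv x).le
  continuousOn := (poissonGaussianPDF_continuous β μ d r hv).continuousOn
  eq_zero x hx := absurd (Set.mem_univ x) hx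
  hasLaw := poissonGaussian_eq_withDensity β μ d r hv ▸ hX

theorem ProbabilityTheory.HasLaw.cgf_poissonGaussian
    (hX : HasLaw X (poissonGaussian β μ v d r) P) : cgf X P = cumulant β μ v d r := by
  ext s
  rw [cgf, hX.mgf_poissonGaussian, Real.log_exp, cumulant]

theorem ProbabilityTheory.HasLaw.deriv_cgf_poissonGaussian
    (hX : HasLaw X (poissonGaussian β μ v d r) P) :
    deriv (cgf X P) = cumulantDeriv β μ v d r := by
  ext s
  rw [hX.cgf_poissonGaussian, (hasDerivAt_cumulant s).deriv]

theorem ProbabilityTheory.HasLaw.iteratedDeriv_two_cgf_poissonGaussian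
    (hX : HasLaw X (poissonGaussian β μ v d r) P) (s : ℝ) :
    iteratedDeriv 2 (cgf X P) s = cumulantDeriv₂ μ v d r s := by
  rw [iteratedDeriv_succ, iteratedDeriv_one, hX.deriv_cgf_poissonGaussian,
    (hasDerivAt_cumulantDeriv s).deriv]

end law

theorem mainTheorem5 {Ω : Type*} [MeasurableSpace Ω] (P : Measure Ω) [IsProbabilityMeasure P]
    (b σ μ : ℝ) (lam δ T : ℝ≥0) (hσ : 0 < σ) (hlam : 0 < lam) (hδ : 0 < δ) (hT : 0 < T)
    (W : ℝ≥0 → Ω → ℝ) (N : ℝ≥0 → Ω → ℕ) (Y : ℕ → Ω → ℝ)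
    (hinput : IsMertonInput W N Y lam μ δ P) :
    -- all exponential moments of the log-return exist
    (∀ s : ℝ, Integrable (fun ω => Real.exp (s * logReturn b σ W N Y T ω)) P) ∧
    ∃ (shat f g : ℝ → ℝ),
      -- `shat k` is the unique solution of the saddle point equation
      (∀ k s : ℝ, deriv (cgf (logReturn b σ W N Y T) P) s = k ↔ s = shat k) ∧
      -- `f` is the density of `X_T` and `g` the density of `S_T`
      IsContinuousDensityOn f Set.univ (logReturn b σ W N Y T) P ∧
      IsContinuousDensityOn g (Set.Ioi 0) (spot b σ W N Y T) P ∧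
      (∃ ε : ℝ → ℝ, ε =O[atTop] (fun k : ℝ => k ^ (-(1 / 2) : ℝ)) ∧
        ∀ᶠ k in atTop, f k =
          Real.exp (-k * shat k) * mgf (logReturn b σ W N Y T) P (shat k) /
            √(2 * Real.pi * iteratedDeriv 2 (cgf (logReturn b σ W N Y T) P) (shat k)) *
          (1 + ε k)) ∧
      (∃ ε : ℝ → ℝ, ε =O[atTop] (fun k : ℝ => k ^ (-(1 / 2) : ℝ)) ∧
        ∀ᶠ k in atTop, f k =
          Real.exp (-k * shat k + T * (σ ^ 2 / 2 * shat k ^ 2 + b * shat k +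
              lam * (Real.exp (δ ^ 2 / 2 * shat k ^ 2 + μ * shat k) - 1))) /
            √(2 * Real.pi * T * (σ ^ 2 + lam * ((δ ^ 2 * shat k + μ) ^ 2 + δ ^ 2) *
              Real.exp (δ ^ 2 * shat k ^ 2 / 2 + μ * shat k))) *
          (1 + ε k)) ∧
      (∃ r : ℝ → ℝ, r =O[atTop] (fun k : ℝ => k) ∧
        ∀ᶠ k in atTop, f k = Real.exp (-(√2 / δ) * k * √(Real.log k) + r k)) ∧
      (∀ x : ℝ, 0 < x → g x = f (Real.log x) / x) ∧
      (∃ r : ℝ → ℝ, r =O[atTop] Real.log ∧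
        ∀ᶠ x in atTop, g x =
          x ^ (-(√2 / δ) * √(Real.log (Real.log x))) * Real.exp (r x)) := by
  lift σ to ℝ≥0 using hσ.le
  have hσ' : 0 < σ := by exact_mod_cast hσ
  have hX : HasLaw (logReturn b σ W N Y T)
      (poissonGaussian (b * T) μ (σ ^ 2 * T) (δ ^ 2) (lam * T)) P := hasLaw_logReturn hinput
  have hv : 0 < σ ^ 2 * T := by positivity
  have hd : 0 < δ ^ 2 := by positivity
  have hr : 0 < lam * T := by positivity
  have hv' : (0 : ℝ) < (σ ^ 2 * T : ℝ≥0) := hv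
  have hd' : (0 : ℝ) < (δ ^ 2 : ℝ≥0) := hd
  have hr' : (0 : ℝ) < (lam * T : ℝ≥0) := hr
  obtain ⟨shat, hshat, hlim⟩ := exists_saddlePoint (b * T) μ hv' hd' hr'
  have hk : ∀ k, cumulantDeriv (b * T) μ (σ ^ 2 * T : ℝ≥0) (δ ^ 2 : ℝ≥0) (lam * T : ℝ≥0)
      (shat k) = k := fun k => (hshat k _).2 rfl
  have hf : ∀ k, poissonGaussianPDF (b * T) μ (σ ^ 2 * T) (δ ^ 2) (lam * T) k =
      Real.exp (cumulant (b * T) μ (σ ^ 2 * T : ℝ≥0) (δ ^ 2 : ℝ≥0) (lam * T : ℝ≥0) (shat k) -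
        shat k * k) /
        √(2 * Real.pi * cumulantDeriv₂ μ (σ ^ 2 * T : ℝ≥0) (δ ^ 2 : ℝ≥0) (lam * T : ℝ≥0) (shat k)) *
          (1 + saddleError μ (σ ^ 2 * T) (δ ^ 2) (lam * T) (shat k)) := fun k => by
    have := poissonGaussianPDF_eq_saddleError (b * T) μ hv hd hr (shat k)
    rwa [hk] at this
  have hpos := poissonGaussianPDF_pos (b * T) μ (δ ^ 2) (lam * T) hv
  have hcont := hX.isContinuousDensityOn_poissonGaussian hv
  have hε : (fun k => saddleError μ (σ ^ 2 * T) (δ ^ 2) (lam * T) (shat k)) =O[atTop]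
      fun k : ℝ => k ^ (-(1 / 2) : ℝ) := by
    have h := (saddleError_isBigO (b * T) μ hv hd hr).comp_tendsto hlim
    refine h.congr_right fun k => ?_
    rw [Function.comp_apply, hk]
  set f := poissonGaussianPDF (b * T) μ (σ ^ 2 * T) (δ ^ 2) (lam * T) with hfdef
  -- The remainder is defined by solving for it; positivity of `f` makes the exponential identity
  -- exact for every `k`, and only its size needs asymptotics.
  set R : ℝ → ℝ := fun k => Real.log (f k) + √2 / δ * k * √(Real.log k) with hR
  have hfR : ∀ k, f k = Real.exp (-(√2 / δ) * k * √(Real.log k) + R k) := by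
    intro k
    have e : -(√2 / δ) * k * √(Real.log k) + R k = Real.log (f k) := by rw [hR]; ring
    rw [e, Real.exp_log (hpos k)]
  have hRO : R =O[atTop] fun k : ℝ => k := by
    obtain ⟨C, hC⟩ := exists_abs_log_poissonGaussianPDF_le (b * T) μ hv hd hr
    refine IsBigO.of_bound C ?_
    filter_upwards [hlim.eventually hC, eventually_ge_atTop 0] with k h h0
    rw [hk, ← hfdef] at h
    rw [Real.norm_eq_abs, Real.norm_of_nonneg h0]
    convert h using 2
    rw [hR]
    have hδ0 : (0 : ℝ) < δ := hδ
    have e : √(2 * (δ ^ 2 : ℝ≥0) * Real.log k) = √2 * δ * √(Real.log k) := by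
      push_cast
      rw [Real.sqrt_mul (by positivity), Real.sqrt_mul (by positivity), Real.sqrt_sq hδ0.le]
    simp only [e]
    push_cast
    field_simp
  refine ⟨hX.integrable_exp_mul_poissonGaussian, shat, f,
    fun x => if 0 < x then f (Real.log x) / x else 0, ?_, hcont, hcont.exp,
    ⟨_, hε, .of_forall fun k => ?_⟩, ⟨_, hε, .of_forall fun k => ?_⟩,
    ⟨R, hRO, .of_forall hfR⟩, fun x hx => if_pos hx, ?_⟩
  · rw [hX.deriv_cgf_poissonGaussian]
    exact hshat
  · rw [hX.mgf_poissonGaussian, hX.iteratedDeriv_two_cgf_poissonGaussian, hf, ← Real.exp_add]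
    congr 3
    rw [cumulant]
    ring
  · rw [hf, cumulant, cumulantDeriv₂, tiltedRate]
    push_cast
    congr 2
    · congr 1
      ring_nf
    · congr 1
      ring
  -- The factor `1/x` of the change of variables is `exp(-log x)`, hence the extra `-log x`, which
  -- the `O(log x)` term absorbs.
  · refine ⟨fun x => R (Real.log x) - Real.log x,
      (hRO.comp_tendsto Real.tendsto_log_atTop).sub (isBigO_refl _ _), ?_⟩
    filter_upwards [eventually_gt_atTop 0] with x hx
    rw [if_pos hx, hfR, Real.rpow_def_of_pos hx, ← Real.exp_add]
    nth_rewrite 4 [← Real.exp_log hx]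
    rw [← Real.exp_sub]
    congr 1
    ring
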